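/- **Theorem.** The *Kari–Culik tiles* are the 13 unit squares with edge labels (bottom, left, top, right) given by six tiles of type $\tfrac13$, $(1,\tfrac03,0,\tfrac13)$, $(1,\tfrac13,0,\tfrac23)$, $(1,\tfrac23,1,\tfrac03)$, $(2,\tfrac03,0,\tfrac23)$, $(2,\tfrac13,1,\tfrac03)$, $(2,\tfrac23,1,\tfrac13)$, and seven tiles of type $2$, $(0,0,0',0)$, $(0,0,1,-1)$, $(0,-1,0',-1)$, $(0',0,1,-1)$, $(1,0,2,0)$, $(1,-1,1,0)$, $(1,-1,2,-1)$, where $0,0'$ are different labels and so are $\tfrac03,0$. A tiling $y$ assigns a tile to every point of $\mathbb Z^2$ so that adjacent edges carry equal labels; rows are numbered upwards. Let $\Phi(y)\in\{0,1,2\}^{\mathbb Z^2}$ be its array of bottom labels, with $0'$ read as $0$. For $\alpha,t\in\mathbb R$ let $\mathbf R_{\lfloor\cdot\rfloor}(\alpha,t)$ be the sequence $(\lfloor n\alpha+t\rfloor-\lfloor (n-1)\alpha+t\rfloor)_{n\in\mathbb Z}$ and let $\mathbf R_{\lceil\cdot\rceil}(\alpha,t)$ be the same with ceilings; these are the Sturmian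 sequences (they depend on $t$ modulo $1$ only), and the generalized Sturmian sequences are their limits in the product of discrete topologies. Let $KC$ be the set of tilings $y$ for which every row of $\Phi(y)$ is a generalized Sturmian sequence, and $KC_{\mathbb Q^c}\subset KC$ the set of those for which every row of $\Phi(y)$ has an irrational angle (average $\lim_n\frac1{2n+1}\sum_{|i|\le n}x_i$). Let $T$ and $S$ be the horizontal and the vertical shift, $(Ty)_{m,n}=y_{m,n+1}$ and $(Sy)_{m,n}=y_{m+1,n}$ ($m$ the row, $n$ the column); they preserve $KC$ and $KC_{\mathbb Q^c}$. Let $\mathcal T=\varprojlim \mathbb R/6^n\mathbb Z$, $n\ge0$. For $t=(t_0,t_1,\dots)\in\mathcal T$ and $r\in\mathbb R$ put $t+r=(t_n+r \bmod 6^n)_n$, $2t=(2t_n)_n$ and $t/3=2\cdot(t_{n+1}/6)_n$. Let $\hat f:[\tfrac13,2]\times\mathcal T\to[\tfrac13,2]\times\mathcal T$ be $\hat f(\alpha,t)=(2\alpha,2t)$ for $\alpha\in[\tfrac13,1)$ and $\hat f(\alpha,t)=(\alpha/3,t/3)$ for $\alpha\in[1,2]$. There are maps $$K:[\tfrac13,2]\times\mathcal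 T\times\{\mathbf R_{\lfloor\cdot\rfloor},\mathbf R_{\lceil\cdot\rceil}\}\to KC,\qquad K':KC_{\mathbb Q^c}\to[\tfrac13,2]\times\mathcal T\times\{\mathbf R_{\lfloor\cdot\rfloor},\mathbf R_{\lceil\cdot\rceil}\}$$ such that: 1. $K(K'(y))=y$ for all $y\in KC_{\mathbb Q^c}$. 2. If $y\in KC_{\mathbb Q^c}$ and $K'(y)=(\alpha,t,R)$, then $K'(Ty)=(\alpha,t+\alpha,R)$ and $K'(Sy)=(\hat f(\alpha,t),R)$. 3. If $\alpha\ne2$, then $(\alpha,t)$ has a two-sided orbit $(\alpha_m,t_m)_{m\in\mathbb Z}$ under $\hat f$ (that is, $(\alpha_0,t_0)=(\alpha,t)$ and $(\alpha_{m+1},t_{m+1})=\hat f(\alpha_m,t_m)$ for all $m\in\mathbb Z$) such that for every $m$ the $m$-th row of $\Phi(K(\alpha,t,R))$ is $R(\alpha_m,s_m)$, where $s_m\in\mathbb R/\mathbb Z$ is the $0$-th coordinate of $t_m$. 4. $K(\alpha,t+\alpha,R)=T K(\alpha,t,R)$ and $K(\hat f(\alpha,t),R)=S K(\alpha,t,R)$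 for all $(\alpha,t,R)$. 5. If $\alpha$ is irrational, then $K(\alpha,t,R)\in KC_{\mathbb Q^c}$, and the first two components of $K'(K(\alpha,t,R))$ are $(\alpha,t)$. In particular, up to the choice between floor and ceiling, the $\mathbb Z^2$-action by translation on $KC_{\mathbb Q^c}$ is conjugate to the skew product on $([\tfrac13,2]\setminus\mathbb Q)\times\mathcal T$ generated by $(\alpha,t)\mapsto(\alpha,t+\alpha)$ and $\hat f$. -/

import Mathlib

open Filter Topology

noncomputable section

/-! ### The thirteen Kari-Culik tiles -/

/-- Labels of bottom and top edges: `0`, `0'`, `1`, `2`. -/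
inductive VLabel where
  | zero : VLabel
  | zeroPrime : VLabel
  | one : VLabel
  | two : VLabel

/-- Labels of left and right edges: `0/3`, `1/3`, `2/3` (for tiles of type `1/3`) and
`0`, `-1` (for tiles of type `2`). The labels `0/3` and `0` are different colours. -/
inductive HLabel where
  | zeroThirds : HLabel
  | oneThird : HLabel
  | twoThirds : HLabel
  | zero : HLabel
  | negOne : HLabel

/-- A square with labelled edges; the labels are listed clockwise from the bottom. -/
structure WangTile where
  bottom : VLabel
  left : HLabel
  top : VLabel
  right : HLabel

/-- The 13 Kari-Culik tiles `(bottom, left, top, right)`. The first six are of type `1/3` and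
satisfy `bottom / 3 + left = top + right`, the last seven are of type `2` and satisfy
`2 * bottom + left = top + right`. A `0` on top of a tile of type `1/3` is the label `0`, a `0` on
top of a tile of type `2` is the label `0'`. -/
def kariCulikTiles : Set WangTile :=
  { ⟨.one, .zeroThirds, .zero, .oneThird⟩,
    ⟨.one, .oneThird, .zero, .twoThirds⟩,
    ⟨.one, .twoThirds, .one, .zeroThirds⟩,
    ⟨.two, .zeroThirds, .zero, .twoThirds⟩,
    ⟨.two, .oneThird, .one, .zeroThirds⟩,
    ⟨.two, .twoThirds, .one, .oneThird⟩,
    ⟨.zero, .zero, .zeroPrime, .zero⟩,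
    ⟨.zero, .zero, .one, .negOne⟩,
    ⟨.zero, .negOne, .zeroPrime, .negOne⟩,
    ⟨.zeroPrime, .zero, .one, .negOne⟩,
    ⟨.one, .zero, .two, .zero⟩,
    ⟨.one, .negOne, .one, .zero⟩,
    ⟨.one, .negOne, .two, .negOne⟩ }

/-- A configuration on `ℤ²`: `y m n` is the tile in row `m` (rows are numbered upwards) and
column `n` (columns are numbered from left to right). -/
abbrev Configuration : Type := ℤ → ℤ → WangTile

/-- `y` is a Kari-Culik tiling. -/
def IsKariCulikTiling (y : Configuration) : Prop :=
  (∀ m n, y m n ∈ kariCulikTiles) ∧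
  (∀ m n, (y m n).right = (y m (n + 1)).left) ∧
  (∀ m n, (y m n).top = (y (m + 1) n).bottom)

/-- The numerical value of a bottom label; `0'` is sent to `0`. -/
def VLabel.value : VLabel → ℤ
  | .zero => 0
  | .zeroPrime => 0
  | .one => 1
  | .two => 2

/-- The projection `Φ` to bottom labels; `bottomLabels y m` is its `m`-th row. -/
def bottomLabels (y : Configuration) (m : ℤ) : ℤ → ℤ := fun n => (y m n).bottom.value

/-! ### Rotation sequences and generalized Sturmian sequences -/

/-- The choice between the floor and the ceiling function. -/
inductive Rounding where
  | floor : Rounding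
  | ceil : Rounding

/-- The rounding function. -/
def Rounding.round : Rounding → ℝ → ℤ
  | .floor, x => ⌊x⌋
  | .ceil, x => ⌈x⌉

/-- The rotation sequence with angle `α` and phase `t`. -/
def rotationSeq (R : Rounding) (α t : ℝ) : ℤ → ℤ := fun n =>
  R.round ((n : ℝ) * α + t) - R.round (((n : ℝ) - 1) * α + t)

/-- Sturmian sequences (periodic ones are allowed). -/
def sturmianSeqs : Set (ℤ → ℤ) := {x | ∃ (R : Rounding) (α t : ℝ), x = rotationSeq R α t}

/-- Generalized Sturmian sequences: the closure of the Sturmian sequences in the product of the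
discrete topologies. -/
def generalizedSturmianSeqs : Set (ℤ → ℤ) := closure sturmianSeqs

/-- `x` has angle `a`: its symbols have the average `a`. -/
def HasAngle (x : ℤ → ℤ) (a : ℝ) : Prop :=
  Tendsto (fun n : ℕ => (∑ i ∈ Finset.Icc (-(n : ℤ)) (n : ℤ), (x i : ℝ)) / (2 * (n : ℝ) + 1))
    atTop (𝓝 a)

/-- `KC`: the Kari-Culik tilings whose rows of bottom labels are generalized Sturmian. -/
def KC : Set Configuration :=
  {y | IsKariCulikTiling y ∧ ∀ m, bottomLabels y m ∈ generalizedSturmianSeqs}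

/-- The tilings in `KC` all of whose rows have an irrational angle. -/
def KCirr : Set Configuration :=
  {y | y ∈ KC ∧ ∀ m, ∃ a : ℝ, Irrational a ∧ HasAngle (bottomLabels y m) a}

/-! ### The translations -/

/-- The horizontal shift. -/
def shiftT (y : Configuration) : Configuration := fun m n => y m (n + 1)

/-- The vertical shift. -/
def shiftS (y : Configuration) : Configuration := fun m n => y (m + 1) n

lemma shift_mem_generalizedSturmianSeqs {x : ℤ → ℤ} (hx : x ∈ generalizedSturmianSeqs) :
    (fun n => x (n + 1)) ∈ generalizedSturmianSeqs := by
  have hc : Continuous (fun (z : ℤ → ℤ) (n : ℤ) => z (n + 1)) :=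
    continuous_pi fun n => continuous_apply (n + 1)
  refine map_mem_closure hc hx ?_
  rintro z ⟨R, α, t, rfl⟩
  refine ⟨R, α, t + α, ?_⟩
  funext n
  simp only [rotationSeq]
  congr 2 <;> push_cast <;> ring

lemma VLabel.value_bound (v : VLabel) : |(v.value : ℝ)| ≤ 2 := by
  cases v <;> norm_num [VLabel.value]

lemma HasAngle.shift {x : ℤ → ℤ} {a : ℝ} (hb : ∀ n, |(x n : ℝ)| ≤ 2) (hx : HasAngle x a) :
    HasAngle (fun n => x (n + 1)) a := by
  have hsum : ∀ n : ℕ, ∑ i ∈ Finset.Icc (-(n : ℤ)) (n : ℤ), (x (i + 1) : ℝ)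
      = ∑ i ∈ Finset.Icc (-(n : ℤ)) (n : ℤ), (x i : ℝ) + (x ((n : ℤ) + 1) - x (-(n : ℤ))) := by
    intro n
    have h1 : ∑ i ∈ Finset.Icc (-(n : ℤ)) (n : ℤ), (x (i + 1) : ℝ)
        = ∑ i ∈ Finset.Icc (-(n : ℤ) + 1) ((n : ℤ) + 1), (x i : ℝ) := by
      rw [← Finset.map_add_right_Icc, Finset.sum_map]
      rfl
    have h2 : insert (-(n : ℤ)) (Finset.Icc (-(n : ℤ) + 1) ((n : ℤ) + 1))
        = insert ((n : ℤ) + 1) (Finset.Icc (-(n : ℤ)) (n : ℤ)) := by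
      ext i
      simp only [Finset.mem_insert, Finset.mem_Icc]
      omega
    have h3 := congrArg (fun s : Finset ℤ => ∑ i ∈ s, (x i : ℝ)) h2
    beta_reduce at h3
    rw [Finset.sum_insert (by simp), Finset.sum_insert (by simp)] at h3
    rw [h1]
    linarith
  have h0 : Tendsto (fun n : ℕ => ((x ((n : ℤ) + 1) - x (-(n : ℤ)) : ℝ)) / (2 * (n : ℝ) + 1))
      atTop (𝓝 0) := by
    have hinf : Tendsto (fun n : ℕ => 2 * (n : ℝ) + 1) atTop atTop :=
      tendsto_atTop_add_const_right _ _
        (tendsto_natCast_atTop_atTop.const_mul_atTop (by norm_num))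
    have hlim : Tendsto (fun n : ℕ => 4 / (2 * (n : ℝ) + 1)) atTop (𝓝 0) :=
      hinf.const_div_atTop 4
    refine squeeze_zero_norm (fun n => ?_) hlim
    have hpos : (0 : ℝ) < 2 * (n : ℝ) + 1 := by positivity
    rw [Real.norm_eq_abs, abs_div, abs_of_pos hpos]
    refine div_le_div_of_nonneg_right ?_ hpos.le
    have := abs_sub (x ((n : ℤ) + 1) : ℝ) (x (-(n : ℤ)))
    linarith [hb ((n : ℤ) + 1), hb (-(n : ℤ))]
  have := Tendsto.add hx h0
  rw [add_zero] at this
  refine this.congr fun n => ?_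
  rw [hsum n, add_div]

lemma shiftT_mem_KC {y : Configuration} (hy : y ∈ KC) : shiftT y ∈ KC :=
  ⟨⟨fun m n => hy.1.1 m (n + 1), fun m n => hy.1.2.1 m (n + 1), fun m n => hy.1.2.2 m (n + 1)⟩,
    fun m => shift_mem_generalizedSturmianSeqs (hy.2 m)⟩

lemma shiftS_mem_KC {y : Configuration} (hy : y ∈ KC) : shiftS y ∈ KC :=
  ⟨⟨fun m n => hy.1.1 (m + 1) n, fun m n => hy.1.2.1 (m + 1) n, fun m n => hy.1.2.2 (m + 1) n⟩,
    fun m => hy.2 (m + 1)⟩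

lemma shiftT_mem_KCirr {y : Configuration} (hy : y ∈ KCirr) : shiftT y ∈ KCirr := by
  refine ⟨shiftT_mem_KC hy.1, fun m => ?_⟩
  obtain ⟨a, ha, hx⟩ := hy.2 m
  have hb : ∀ n, |(bottomLabels y m n : ℝ)| ≤ 2 := fun n => VLabel.value_bound _
  have hs : bottomLabels (shiftT y) m = fun n => bottomLabels y m (n + 1) := rfl
  refine ⟨a, ha, ?_⟩
  rw [hs]
  exact HasAngle.shift hb hx

lemma shiftS_mem_KCirr {y : Configuration} (hy : y ∈ KCirr) : shiftS y ∈ KCirr :=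
  ⟨shiftS_mem_KC hy.1, fun m => hy.2 (m + 1)⟩

/-- The horizontal shift on `KC`. -/
def KC.T (y : KC) : KC := ⟨shiftT y, shiftT_mem_KC y.2⟩

/-- The vertical shift on `KC`. -/
def KC.S (y : KC) : KC := ⟨shiftS y, shiftS_mem_KC y.2⟩

/-- The horizontal shift on `KCirr`. -/
def KCirr.T (y : KCirr) : KCirr := ⟨shiftT y, shiftT_mem_KCirr y.2⟩

/-- The vertical shift on `KCirr`. -/
def KCirr.S (y : KCirr) : KCirr := ⟨shiftS y, shiftS_mem_KCirr y.2⟩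

/-! ### The inverse limit of the groups `ℝ / 6ⁿℤ` -/

/-- The homomorphism `ℝ / pℤ → ℝ / qℤ` induced by `x ↦ c * x`, when `c * p ∈ qℤ`. -/
def circleMul (c p q : ℝ) (h : c * p ∈ AddSubgroup.zmultiples q) : AddCircle p →+ AddCircle q :=
  QuotientAddGroup.map (AddSubgroup.zmultiples p) (AddSubgroup.zmultiples q)
    (AddMonoidHom.mulLeft c) (by
      rw [AddSubgroup.zmultiples_le]
      exact h)

/-- Reduction `ℝ / 6ⁿ⁺¹ℤ → ℝ / 6ⁿℤ`. -/
def reduceSix (n : ℕ) : AddCircle ((6 : ℝ) ^ (n + 1)) →+ AddCircle ((6 : ℝ) ^ n) :=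
  circleMul 1 _ _ (AddSubgroup.mem_zmultiples_iff.2 ⟨6, by rw [pow_succ]; simp; ring⟩)

/-- Division by six, `ℝ / 6ⁿ⁺¹ℤ → ℝ / 6ⁿℤ`, `x ↦ x / 6`. -/
def divSix (n : ℕ) : AddCircle ((6 : ℝ) ^ (n + 1)) →+ AddCircle ((6 : ℝ) ^ n) :=
  circleMul (1 / 6) _ _ (AddSubgroup.mem_zmultiples_iff.2 ⟨1, by rw [pow_succ]; simp; ring⟩)

/-- The inverse limit of the groups `ℝ / 6ⁿℤ`, as a subgroup of their product. -/
def solenoid : AddSubgroup (∀ n : ℕ, AddCircle ((6 : ℝ) ^ n)) where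
  carrier := {t | ∀ n, reduceSix n (t (n + 1)) = t n}
  zero_mem' := fun n => by simp
  add_mem' := fun {a b} ha hb n => by
    have h1 := ha n
    have h2 := hb n
    simp only [Pi.add_apply, map_add, h1, h2]
  neg_mem' := fun {a} ha n => by
    have h1 := ha n
    simp only [Pi.neg_apply, map_neg, h1]

/-- The image `(r mod 6ⁿ)ₙ` of a real number `r` in the inverse limit. -/
def solenoidOfReal (r : ℝ) : solenoid :=
  ⟨fun _ => (r : AddCircle _), fun n => by
    change ((1 * r : ℝ) : AddCircle ((6 : ℝ) ^ n)) = _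
    rw [one_mul]⟩

/-- Division by six on the inverse limit: `(t₀, t₁, …) ↦ (t₁ / 6, t₂ / 6, …)`. -/
def solenoidDivSix (t : solenoid) : solenoid :=
  ⟨fun n => divSix n (t.1 (n + 1)), fun n => by
    have h := t.2 (n + 1)
    change reduceSix n (divSix (n + 1) (t.1 (n + 1 + 1))) = divSix n (t.1 (n + 1))
    rw [← h]
    generalize t.1 (n + 1 + 1) = u
    induction u using QuotientAddGroup.induction_on with
    | H x =>
      change ((1 * (1 / 6 * x) : ℝ) : AddCircle ((6 : ℝ) ^ n))
        = ((1 / 6 * (1 * x) : ℝ) : AddCircle ((6 : ℝ) ^ n))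
      congr 1
      ring⟩

/-- Multiplication by two on the inverse limit. -/
def solenoidDouble (t : solenoid) : solenoid := 2 • t

/-- Division by three on the inverse limit, `t / 3 = 2 (t / 6)`. -/
def solenoidDivThree (t : solenoid) : solenoid := 2 • solenoidDivSix t

/-! ### The skew product -/

/-- The space `[1/3, 2] × lim ℝ / 6ⁿℤ`. -/
abbrev ParamSpace : Type := Set.Icc (1 / 3 : ℝ) 2 × solenoid

/-- `f(α) = 2α` on `[1/3, 1)` and `f(α) = α / 3` on `[1, 2]`. -/
def angleMap (α : Set.Icc (1 / 3 : ℝ) 2) : Set.Icc (1 / 3 : ℝ) 2 :=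
  if h : (α : ℝ) < 1 then ⟨2 * α, by have := α.2.1; constructor <;> linarith⟩
  else ⟨α / 3, by have := α.2.2; constructor <;> linarith⟩

/-- The extension of `f` to `(α, t) ↦ (2α, 2t)` for `α ∈ [1/3, 1)` and
`(α, t) ↦ (α / 3, t / 3)` for `α ∈ [1, 2]`. -/
def fHat (p : ParamSpace) : ParamSpace :=
  (angleMap p.1, if (p.1 : ℝ) < 1 then solenoidDouble p.2 else solenoidDivThree p.2)

/-- `p` is the two-sided orbit `m ↦ fHatᵐ (q)` of `q`. -/
def IsOrbitOf (p : ℤ → ParamSpace) (q : ParamSpace) : Prop :=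
  p 0 = q ∧ ∀ m, p (m + 1) = fHat (p m)

/-- For each `m`, the `m`-th row of bottom labels of `y` is the rotation sequence whose angle and
phase are `αₘ` and the coordinate in `ℝ / ℤ` of `tₘ`, where `p m = (αₘ, tₘ)`. Rotation sequences
depend on the phase modulo `1` only, so any representative `s` of the phase may be used. -/
def IsCodedBy (y : Configuration) (p : ℤ → ParamSpace) (R : Rounding) : Prop :=
  ∀ (m : ℤ) (s : ℝ), ((s : ℝ) : AddCircle ((6 : ℝ) ^ 0)) = (p m).2.1 0 →
    bottomLabels y m = rotationSeq R (p m).1 s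

end

/-!
A row whose bottom labels are the rotation sequence `n ↦ R(nα + s) - R((n - 1)α + s)` can be put
below the row of angle `kα` and phase `ks` by tiles of type `2` (`k = 2`), or above it by tiles of
type `1/3` (`k = 3`); the vertical edges then carry the carries `R(kx) - k R(x)` at `x = nα + s`.
Angles in `[1/3, 1)` are doubled and angles in `[1, 2)` are divided by three, which is a bijection
of `[1/3, 2)`. On the solenoid, where two and three are invertible, the skew product is therefore
a permutation `skew` of the core `[1/3, 2) × solenoid`, and it commutes with the rotation `rot`.
Hence the tile at `(m, n)` can be read off at the point `skewᵐ (rotⁿ p)`; this gives the tiling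
`tilingOf R p`, whose equivariance is clear. The angle `2` is not in the image of the skew product;
there the tiling is pulled back from the image `2 / 3`.

Conversely (`exists_tilingOf_eq`), let all rows have irrational angles. A primitive `P` of a
generalized Sturmian row of angle `α` satisfies `nα + τ - 1 ≤ P n ≤ nα + τ` (`exists_isBand`). As
the heights `P n - nα` are dense in this band, the tile equations between consecutive rows force
the relation `τ' = kτ` modulo one between their phases (`IsBand.mul_step`). The labels `0` and `0'`
exclude angles below `1/3`, so the angles form an orbit.

The phases form a sequence in `ℝ / ℤ` whose steps are doublings and inverses of triplings
(`IsStepSeq`). Each kind of step keeps recurring with bounded gaps, so such sequences are uniquely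
divisible by two and by three (`IsStepSeq.exists_half`, `IsStepSeq.exists_third`): where
`y' = 2 y` and `x = 3 y`, the term `y` is `x - y'`. The iterated sixth parts are the coordinates of
a point of the solenoid with the given base phases (`exists_orbit`), and unique divisibility
shows that there is only one (`eq_of_basePhase_eq`).

A row is given by the floor unless it touches the lower line of its band, and by the ceiling
unless it touches the upper one. Irrationality confines the contacts of all rows to one column,
and along that column the heights between two contacts are dyadic rationals, so that divisions by
three cannot leave the integers and the contacts are all with the lower or all with the upper line
(`IsDecoding.exists_rounding`). So one rounding serves all rows, and
the carries, hence all labels, are those of `tilingOf`.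
-/

noncomputable section

/-! ### Arithmetic of the solenoid -/

/-- The coordinate of a solenoid point in `ℝ / ℤ`. -/
def basePhase : solenoid →+ AddCircle ((6 : ℝ) ^ 0) :=
  (Pi.evalAddMonoidHom _ 0).comp solenoid.subtype

lemma basePhase_solenoidOfReal (r : ℝ) : basePhase (solenoidOfReal r) = (r : AddCircle _) := rfl

/-- `solenoidDivSix` as a homomorphism. -/
def divSixHom : solenoid →+ solenoid where
  toFun := solenoidDivSix
  map_zero' := by
    ext n
    exact map_zero (divSix n)
  map_add' a b := by
    ext n
    exact map_add (divSix n) _ _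

lemma six_nsmul_divSix (n : ℕ) (u : AddCircle ((6 : ℝ) ^ (n + 1))) :
    6 • divSix n u = reduceSix n u := by
  induction u using QuotientAddGroup.induction_on with
  | H x =>
    change 6 • ((1 / 6 * x : ℝ) : AddCircle ((6 : ℝ) ^ n)) = ((1 * x : ℝ) : AddCircle _)
    rw [← AddCircle.coe_nsmul]
    congr 1
    simp only [nsmul_eq_mul]
    push_cast
    ring

lemma six_nsmul_divSixHom (t : solenoid) : 6 • divSixHom t = t := by
  ext n
  exact (six_nsmul_divSix n (t.1 (n + 1))).trans (t.2 n)

lemma six_nsmul_inj {t u : solenoid} (h : 6 • t = 6 • u) : t = u := by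
  have h' : divSixHom (6 • t) = divSixHom (6 • u) := by rw [h]
  rwa [map_nsmul, map_nsmul, six_nsmul_divSixHom, six_nsmul_divSixHom] at h'

lemma three_nsmul_inj {t u : solenoid} (h : 3 • t = 3 • u) : t = u := by
  apply six_nsmul_inj
  rw [show 6 = 2 * 3 by norm_num, mul_nsmul', mul_nsmul', h]

lemma two_nsmul_inj {t u : solenoid} (h : 2 • t = 2 • u) : t = u := by
  apply six_nsmul_inj
  rw [show 6 = 3 * 2 by norm_num, mul_nsmul', mul_nsmul', h]

lemma three_nsmul_solenoidDivThree (t : solenoid) : 3 • solenoidDivThree t = t := by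
  change 3 • (2 • divSixHom t) = t
  rw [← mul_nsmul', six_nsmul_divSixHom]

lemma two_nsmul_three_nsmul_divSixHom (t : solenoid) : 2 • (3 • divSixHom t) = t := by
  rw [← mul_nsmul', six_nsmul_divSixHom]

lemma solenoidDivThree_add (t u : solenoid) :
    solenoidDivThree (t + u) = solenoidDivThree t + solenoidDivThree u := by
  change 2 • divSixHom (t + u) = 2 • divSixHom t + 2 • divSixHom u
  rw [map_add, nsmul_add]

lemma nsmul_solenoidOfReal (k : ℕ) (r : ℝ) :
    k • solenoidOfReal r = solenoidOfReal (k * r) := by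
  ext n
  change k • (r : AddCircle ((6 : ℝ) ^ n)) = ((k * r : ℝ) : AddCircle _)
  rw [← AddCircle.coe_nsmul, nsmul_eq_mul]

lemma zsmul_solenoidOfReal (k : ℤ) (r : ℝ) :
    k • solenoidOfReal r = solenoidOfReal (k * r) := by
  ext n
  change k • (r : AddCircle ((6 : ℝ) ^ n)) = ((k * r : ℝ) : AddCircle _)
  rw [← AddCircle.coe_zsmul, zsmul_eq_mul]

lemma solenoidDivThree_ofReal (r : ℝ) :
    solenoidDivThree (solenoidOfReal r) = solenoidOfReal (r / 3) := by
  apply three_nsmul_inj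
  rw [three_nsmul_solenoidDivThree, nsmul_solenoidOfReal]
  congr 1
  push_cast
  ring

/-- The coordinate in `ℝ / 6ᵏℤ` of `t` is, after division by `6ʲ`, a lower coordinate of
`t / 6ʲ`. -/
lemma iterate_divSixHom_coord (j : ℕ) : ∀ (t : solenoid) (n k : ℕ), k = n + j → ∀ x : ℝ,
    (x : AddCircle ((6 : ℝ) ^ k)) = t.1 k →
      ((x / 6 ^ j : ℝ) : AddCircle ((6 : ℝ) ^ n)) = (divSixHom^[j] t).1 n := by
  induction j with
  | zero =>
    rintro t n k rfl x hx
    simpa using hx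
  | succ j ih =>
    intro t n k hk x hx
    have h := ih t (n + 1) k (by omega) x hx
    rw [Function.iterate_succ_apply']
    change _ = divSix n ((divSixHom^[j] t).1 (n + 1))
    rw [← h]
    change _ = ((1 / 6 * (x / 6 ^ j) : ℝ) : AddCircle ((6 : ℝ) ^ n))
    congr 1
    rw [pow_succ]
    field_simp

/-- The base phase of `t / 6ʲ`, as a homomorphism in `t`. -/
def sixthPhase : ℕ → solenoid →+ AddCircle ((6 : ℝ) ^ 0)
  | 0 => basePhase
  | j + 1 => (sixthPhase j).comp divSixHom

lemma sixthPhase_eq (j : ℕ) (t : solenoid) :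
    sixthPhase j t = basePhase (divSixHom^[j] t) := by
  induction j generalizing t with
  | zero => rfl
  | succ j ih => exact ih (divSixHom t)

lemma six_pow_nsmul_sixthPhase (j : ℕ) (t : solenoid) :
    6 ^ j • sixthPhase j t = basePhase t := by
  induction j generalizing t with
  | zero => exact one_nsmul _
  | succ j ih =>
    rw [pow_succ', mul_nsmul']
    refine (congrArg (6 • ·) (ih (divSixHom t))).trans ?_
    rw [← map_nsmul, six_nsmul_divSixHom]

lemma sixthPhase_eq_coe (j : ℕ) (t : solenoid) (x : ℝ)
    (hx : (x : AddCircle ((6 : ℝ) ^ j)) = t.1 j) :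
    sixthPhase j t = ((x / 6 ^ j : ℝ) : AddCircle ((6 : ℝ) ^ 0)) :=
  (sixthPhase_eq j t).trans (iterate_divSixHom_coord j t 0 j (by omega) x hx).symm

lemma coe_eq_coe_iff (n : ℕ) (x y : ℝ) :
    (x : AddCircle ((6 : ℝ) ^ n)) = (y : AddCircle ((6 : ℝ) ^ n)) ↔
      ∃ k : ℤ, y = x + k * 6 ^ n := by
  constructor
  · intro h
    obtain ⟨k, hk⟩ := AddSubgroup.mem_zmultiples_iff.1 (QuotientAddGroup.eq.1 h)
    refine ⟨k, ?_⟩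
    rw [zsmul_eq_mul] at hk
    linarith
  · rintro ⟨k, rfl⟩
    refine QuotientAddGroup.eq.2 (AddSubgroup.mem_zmultiples_iff.2 ⟨k, ?_⟩)
    rw [zsmul_eq_mul]
    ring

/-- A point of the solenoid is determined by the base phases of its quotients by powers of six. -/
lemma solenoid_ext {t u : solenoid}
    (h : ∀ j : ℕ, sixthPhase j t = sixthPhase j u) : t = u := by
  ext n
  obtain ⟨x, hx⟩ := QuotientAddGroup.mk_surjective (t.1 n)
  obtain ⟨y, hy⟩ := QuotientAddGroup.mk_surjective (u.1 n)
  have h' := h n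
  rw [sixthPhase_eq_coe n t x hx, sixthPhase_eq_coe n u y hy,
    coe_eq_coe_iff] at h'
  obtain ⟨k, hk⟩ := h'
  refine hx.symm.trans (Eq.trans ?_ hy)
  refine (coe_eq_coe_iff n x y).2 ⟨k, ?_⟩
  have h6 : (6 : ℝ) ^ n ≠ 0 := by positivity
  field_simp at hk
  linarith

/-- A compatible system of sixth parts in `ℝ / ℤ` comes from a point of the solenoid. -/
lemma exists_solenoid (w : ℕ → AddCircle ((6 : ℝ) ^ 0)) (hw : ∀ j, 6 • w (j + 1) = w j) :
    ∃ t : solenoid, ∀ j, sixthPhase j t = w j := by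
  choose x hx using fun j => QuotientAddGroup.mk_surjective (w j)
  have hx' : ∀ j, ((x j : ℝ) : AddCircle ((6 : ℝ) ^ 0)) = w j := hx
  refine ⟨⟨fun n => ((6 ^ n * x n : ℝ) : AddCircle _), fun n => ?_⟩, fun j => ?_⟩
  · change ((1 * (6 ^ (n + 1) * x (n + 1)) : ℝ) : AddCircle ((6 : ℝ) ^ n)) = _
    have h := hw n
    rw [← hx', ← hx', ← AddCircle.coe_nsmul, coe_eq_coe_iff] at h
    obtain ⟨k, hk⟩ := h
    refine (coe_eq_coe_iff n _ _).2 ⟨k, ?_⟩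
    rw [hk, nsmul_eq_mul, pow_succ]
    push_cast
    ring
  · rw [sixthPhase_eq_coe j _ _ rfl, ← hx']
    congr 1
    field_simp

/-! ### Sequences linked by doubling and tripling -/

/-- Along the sequence `x`, the step from `m` to `m + 1` is a doubling when `d m` holds, and the
inverse of a tripling otherwise. -/
def IsStepSeq {A : Type*} [AddCommGroup A] (d : ℤ → Prop) (x : ℤ → A) : Prop :=
  ∀ m, (d m → x (m + 1) = 2 • x m) ∧ (¬ d m → 3 • x (m + 1) = x m)

/-- Inverse triplings are isolated, and there are at most two doublings in a row. -/
def IsAdmissible (d : ℤ → Prop) : Prop :=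
  ∀ m, (d m ∨ d (m + 1)) ∧ ¬ (d m ∧ d (m + 1) ∧ d (m + 2))

namespace IsStepSeq

variable {A B : Type*} [AddCommGroup A] [AddCommGroup B] {d : ℤ → Prop} {x : ℤ → A}

lemma map (hx : IsStepSeq d x) (φ : A →+ B) : IsStepSeq d fun m => φ (x m) := by
  refine fun m => ⟨fun h => ?_, fun h => ?_⟩
  · simp only [(hx m).1 h, map_nsmul]
  · rw [← map_nsmul, (hx m).2 h]

lemma sub {y : ℤ → A} (hx : IsStepSeq d x) (hy : IsStepSeq d y) :
    IsStepSeq d fun m => x m - y m := by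
  refine fun m => ⟨fun h => ?_, fun h => ?_⟩
  · simp only [(hx m).1 h, (hy m).1 h, nsmul_sub]
  · rw [nsmul_sub, (hx m).2 h, (hy m).2 h]

lemma nsmul (hx : IsStepSeq d x) (k : ℕ) : IsStepSeq d fun m => k • x m :=
  hx.map (nsmulAddMonoidHom k)

lemma eq_zero_of_two (hd : IsAdmissible d) (hx : IsStepSeq d x) (h : ∀ m, 2 • x m = 0) (m : ℤ) :
    x m = 0 := by
  have key : ∀ m, d m → x (m + 1) = 0 := fun m hm => by rw [(hx m).1 hm, h]
  obtain ⟨m, rfl⟩ : ∃ k, m = k + 1 + 1 := ⟨m - 2, by ring⟩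
  by_cases h1 : d (m + 1)
  · exact key _ h1
  · have h0 := key m ((hd m).1.resolve_right h1)
    have h3 := (hx (m + 1)).2 h1
    rw [h0] at h3
    have : x (m + 1 + 1) = 3 • x (m + 1 + 1) - 2 • x (m + 1 + 1) := by abel
    rw [this, h3, h, sub_zero]

lemma eq_zero_of_three (hd : IsAdmissible d) (hx : IsStepSeq d x) (h : ∀ m, 3 • x m = 0) (m : ℤ) :
    x m = 0 := by
  have key : ∀ m, ¬ d m → x m = 0 := fun m hm => by rw [← (hx m).2 hm, h]
  have back : ∀ m, x (m + 1) = 0 → x m = 0 := by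
    intro m hm
    by_cases h1 : d m
    · have h2 := (hx m).1 h1
      have : x m = 3 • x m - 2 • x m := by abel
      rw [this, ← h2, h, hm, sub_zero]
    · exact key _ h1
  by_cases h1 : d m
  · by_cases h2 : d (m + 1)
    · refine back _ (back _ (key _ fun h3 => (hd m).2 ⟨h1, h2, ?_⟩))
      rwa [show m + 2 = m + 1 + 1 by ring]
    · exact back _ (key _ h2)
  · exact key _ h1

lemma eq_zero_of_six_pow (hd : IsAdmissible d) (j : ℕ) (hx : IsStepSeq d x)
    (h : ∀ m, 6 ^ j • x m = 0) (m : ℤ) : x m = 0 := by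
  induction j generalizing m with
  | zero => simpa using h m
  | succ j ih =>
    refine ih (fun k => ?_) m
    refine eq_zero_of_two hd (hx.nsmul _) (fun k => ?_) k
    refine eq_zero_of_three hd ((hx.nsmul _).nsmul _) (fun k => ?_) k
    rw [← h k, ← mul_nsmul', ← mul_nsmul']
    congr 1
    ring

/-- A step sequence has a half: after a doubling the half is the previous term, and after an
inverse tripling `3 y = y'` it is recovered as `y = 3 y - 2 y`. -/
lemma exists_half (hd : IsAdmissible d) (hx : IsStepSeq d x) :
    ∃ y : ℤ → A, IsStepSeq d y ∧ ∀ m, 2 • y m = x m := by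
  classical
  have hprev : ∀ m, ¬ d (m - 1) → d (m - 2) := fun m h => by
    refine (hd (m - 2)).1.resolve_right fun h' => h ?_
    rwa [show m - 2 + 1 = m - 1 by ring] at h'
  refine ⟨fun m => if d (m - 1) then x (m - 1) else x (m - 2) - x m, ?_, ?_⟩
  · have hhalf : ∀ m, d (m - 1) → 2 • x (m - 1) = x m := fun m h => by
      rw [← (hx (m - 1)).1 h, sub_add_cancel]
    intro m
    have e1 : m + 1 - 1 = m := by ring
    have e2 : m + 1 - 2 = m - 1 := by ring
    refine ⟨fun h => ?_, fun h => ?_⟩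
    · simp only [e1, h, if_true]
      by_cases h1 : d (m - 1)
      · rw [if_pos h1, hhalf m h1]
      · rw [if_neg h1]
        have h2 := (hx (m - 2)).1 (hprev m h1)
        have h3 := (hx (m - 1)).2 h1
        rw [show m - 2 + 1 = m - 1 by ring] at h2
        rw [sub_add_cancel] at h3
        rw [nsmul_sub, ← h2, ← h3]
        abel
    · simp only [e1, e2, h, if_false]
      have h1 : d (m - 1) := by
        have := hprev (m + 1) (by rwa [e1])
        rwa [e2] at this
      rw [if_pos h1, nsmul_sub, (hx m).2 h, ← hhalf m h1]
      abel
  · intro m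
    by_cases h1 : d (m - 1)
    · simp only [h1, if_true]
      rw [← (hx (m - 1)).1 h1, sub_add_cancel]
    · simp only [h1, if_false]
      have h2 := (hx (m - 2)).1 (hprev m h1)
      have h3 := (hx (m - 1)).2 h1
      rw [show m - 2 + 1 = m - 1 by ring] at h2
      rw [sub_add_cancel] at h3
      rw [nsmul_sub, ← h2, ← h3]
      abel

/-- A step sequence has a third part: before an inverse tripling it is the next term, and before
a doubling `y' = 2 y` it is recovered as `y = 3 y - 2 y`. -/
lemma exists_third (hd : IsAdmissible d) (hx : IsStepSeq d x) :
    ∃ y : ℤ → A, IsStepSeq d y ∧ ∀ m, 3 • y m = x m := by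
  classical
  let y : ℤ → A := fun m => if d m then
      if d (m + 1) then x m - (x (m + 1) - x (m + 1 + 1 + 1)) else x m - x (m + 1 + 1)
    else x (m + 1)
  have hy1 : ∀ m, ¬ d m → y m = x (m + 1) := fun m h => if_neg h
  have hy2 : ∀ m, d m → y m = x m - y (m + 1) := by
    intro m h
    by_cases h1 : d (m + 1)
    · have h2 : ¬ d (m + 1 + 1) := fun h2 => (hd m).2 ⟨h, h1, by
        rwa [show m + 2 = m + 1 + 1 by ring]⟩
      simp only [y, h, h1, h2, if_true, if_false]
    · simp only [y, h, h1, if_true, if_false]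
  have hneg : ∀ m, ¬ d m → 3 • y m = x m := fun m h => by rw [hy1 m h, (hx m).2 h]
  have back : ∀ m, d m → 3 • y (m + 1) = x (m + 1) → 3 • y m = x m := by
    intro m h h1
    rw [hy2 m h, nsmul_sub, h1, (hx m).1 h]
    abel
  have h3 : ∀ m, 3 • y m = x m := by
    intro m
    by_cases h : d m
    · refine back m h ?_
      by_cases h1 : d (m + 1)
      · refine back _ h1 (hneg _ fun h2 => (hd m).2 ⟨h, h1, ?_⟩)
        rwa [show m + 2 = m + 1 + 1 by ring]
      · exact hneg _ h1
    · exact hneg m h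
  refine ⟨y, fun m => ⟨fun h => ?_, fun h => ?_⟩, h3⟩
  · have h4 : y (m + 1) = 3 • y m - y m := by
      rw [h3, hy2 m h]
      abel
    rw [h4]
    abel
  · rw [h3, hy1 m h]

/-- Step sequences are divisible by all powers of six. -/
lemma exists_six_tower (hd : IsAdmissible d) (hx : IsStepSeq d x) :
    ∃ X : ℕ → ℤ → A, X 0 = x ∧ (∀ j, IsStepSeq d (X j)) ∧ ∀ j m, 6 • X (j + 1) m = X j m := by
  have h6 : ∀ y : {y : ℤ → A // IsStepSeq d y}, ∃ z : {y : ℤ → A // IsStepSeq d y},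
      ∀ m, 6 • z.1 m = y.1 m := by
    rintro ⟨y, hy⟩
    obtain ⟨z, hz, hzy⟩ := exists_half hd hy
    obtain ⟨w, hw, hwz⟩ := exists_third hd hz
    refine ⟨⟨w, hw⟩, fun m => ?_⟩
    change 6 • w m = y m
    rw [← hzy m, ← hwz m, ← mul_nsmul']
  choose g hg using h6
  refine ⟨fun j => (g^[j] ⟨x, hx⟩).1, rfl, fun j => (g^[j] ⟨x, hx⟩).2, fun j m => ?_⟩
  simp only [Function.iterate_succ_apply']
  exact hg _ m

end IsStepSeq

/-! ### Bands around a line of irrational slope -/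

/-- `P` is a primitive of the two-sided sequence `x`. -/
def IsPrimitive (x P : ℤ → ℤ) : Prop := ∀ n, P n - P (n - 1) = x n

/-- The graph of the integer sequence `P` lies between the lines `n ↦ n * α + τ - 1` and
`n ↦ n * α + τ`. -/
def IsBand (α τ : ℝ) (P : ℤ → ℤ) : Prop :=
  ∀ n : ℤ, (n : ℝ) * α + τ - 1 ≤ P n ∧ (P n : ℝ) ≤ n * α + τ

/-- The least integer that bounds `R.round x - x` from above for all real `x`. -/
def Rounding.offset : Rounding → ℤ
  | .floor => 0
  | .ceil => 1

lemma Rounding.round_le (R : Rounding) (x : ℝ) : (R.round x : ℝ) ≤ x + R.offset := by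
  cases R
  · simpa [Rounding.round, Rounding.offset] using Int.floor_le x
  · simpa [Rounding.round, Rounding.offset] using (Int.ceil_lt_add_one x).le

lemma Rounding.le_round (R : Rounding) (x : ℝ) : x + R.offset - 1 ≤ (R.round x : ℝ) := by
  cases R
  · simpa [Rounding.round, Rounding.offset] using (Int.sub_one_lt_floor x).le
  · simpa [Rounding.round, Rounding.offset] using Int.le_ceil x

lemma Rounding.round_add_int (R : Rounding) (x : ℝ) (k : ℤ) :
    R.round (x + k) = R.round x + k := by
  cases R
  · exact Int.floor_add_intCast x k
  · exact Int.ceil_add_intCast x k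

lemma Rounding.round_sub_round_lt (R : Rounding) (x y : ℝ) :
    (R.round x : ℝ) - R.round y < x - y + 1 := by
  cases R
  · have := Int.floor_le x
    have := Int.sub_one_lt_floor y
    simp only [Rounding.round]
    linarith
  · have := Int.le_ceil y
    have := Int.ceil_lt_add_one x
    simp only [Rounding.round]
    linarith

lemma isBand_round (R : Rounding) (α s : ℝ) :
    IsBand α (s + R.offset) fun n => R.round (n * α + s) := fun n => by
  have h1 := R.round_le (n * α + s)
  have h2 := R.le_round (n * α + s)
  constructor <;> linarith

lemma isPrimitive_rotationSeq (R : Rounding) (α s : ℝ) :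
    IsPrimitive (rotationSeq R α s) fun n => R.round (n * α + s) := fun n => by
  simp [rotationSeq]

lemma exists_isPrimitive (x : ℤ → ℤ) : ∃ P, IsPrimitive x P := by
  refine ⟨fun n => ∑ i ∈ Finset.Ioc 0 n, x i - ∑ i ∈ Finset.Ioc n 0, x i, fun n => ?_⟩
  beta_reduce
  rcases le_or_gt n 0 with h | h
  · rw [Finset.Ioc_eq_empty_of_le h, Finset.Ioc_eq_empty_of_le (by omega : n - 1 ≤ 0),
      show Finset.Ioc (n - 1) 0 = insert n (Finset.Ioc n 0) by
        ext i; simp only [Finset.mem_Ioc, Finset.mem_insert]; omega,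
      Finset.sum_insert (by simp)]
    simp
  · rw [Finset.Ioc_eq_empty_of_le h.le, Finset.Ioc_eq_empty_of_le (by omega : 0 ≤ n - 1),
      show Finset.Ioc 0 n = insert n (Finset.Ioc 0 (n - 1)) by
        ext i; simp only [Finset.mem_Ioc, Finset.mem_insert]; omega,
      Finset.sum_insert (by simp)]
    simp

lemma IsPrimitive.sub_eq_sub {x y P Q : ℤ → ℤ} {u v : ℤ} (hP : IsPrimitive x P)
    (hQ : IsPrimitive y Q) (huv : u ≤ v) (h : ∀ i, u < i → i ≤ v → x i = y i) :
    P v - P u = Q v - Q u := by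
  induction v, huv using Int.leInduction with
  | base => simp
  | succ v hv ih =>
    have h1 := hP (v + 1)
    have h2 := hQ (v + 1)
    rw [add_sub_cancel_right] at h1 h2
    have h3 := h (v + 1) (by omega) le_rfl
    have h4 := ih fun i hi hi' => h i hi (by omega)
    omega

lemma eq_of_forall_eq_succ {A : Type*} {f : ℤ → A} (h : ∀ n, f (n + 1) = f n) (n : ℤ) :
    f n = f 0 := by
  induction n with
  | zero => rfl
  | succ n ih => rw [h, ih]
  | pred n ih => rw [← ih, ← h (-(n : ℤ) - 1), sub_add_cancel]

lemma IsPrimitive.exists_const {x P Q : ℤ → ℤ} (hP : IsPrimitive x P) (hQ : IsPrimitive x Q) :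
    ∃ c, ∀ n, P n = Q n + c := by
  refine ⟨P 0 - Q 0, fun n => ?_⟩
  have := eq_of_forall_eq_succ (f := fun n => P n - Q n) (fun n => by
    have h1 := hP (n + 1)
    have h2 := hQ (n + 1)
    rw [add_sub_cancel_right] at h1 h2
    omega) n
  beta_reduce at this
  omega

lemma IsPrimitive.sum_Icc {x P : ℤ → ℤ} (hP : IsPrimitive x P) (n : ℕ) :
    ∑ i ∈ Finset.Icc (-(n : ℤ)) n, (x i : ℝ) = P n - P (-(n : ℤ) - 1) := by
  induction n with
  | zero => simp [← hP 0]
  | succ n ih =>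
    rw [show Finset.Icc (-((n + 1 : ℕ) : ℤ)) ((n + 1 : ℕ) : ℤ)
        = insert ((n : ℤ) + 1) (insert (-(n : ℤ) - 1) (Finset.Icc (-(n : ℤ)) n)) by
          ext i; simp only [Finset.mem_Icc, Finset.mem_insert]; push_cast; omega,
      Finset.sum_insert, Finset.sum_insert, ih]
    · have h1 := hP (n + 1)
      have h2 := hP (-(n : ℤ) - 1)
      rw [add_sub_cancel_right] at h1
      rw [← h1, ← h2]
      push_cast
      rw [show -((n : ℤ) + 1) - 1 = -(n : ℤ) - 1 - 1 by ring]
      ring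
    · simp
    · simp only [Finset.mem_insert, Finset.mem_Icc]
      omega

lemma tendsto_inv_two_mul_add_one :
    Tendsto (fun n : ℕ => 1 / (2 * (n : ℝ) + 1)) atTop (𝓝 0) :=
  (tendsto_atTop_add_const_right _ _
    (tendsto_natCast_atTop_atTop.const_mul_atTop (by norm_num))).const_div_atTop 1

lemma IsBand.hasAngle {x P : ℤ → ℤ} {α τ : ℝ} (h : IsBand α τ P) (hP : IsPrimitive x P) :
    HasAngle x α := by
  refine tendsto_iff_norm_sub_tendsto_zero.2
    (squeeze_zero (fun _ => norm_nonneg _) (fun n => ?_) tendsto_inv_two_mul_add_one)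
  have hpos : (0 : ℝ) < 2 * (n : ℝ) + 1 := by positivity
  rw [hP.sum_Icc, Real.norm_eq_abs, div_sub' hpos.ne', abs_div, abs_of_pos hpos]
  refine div_le_div_of_nonneg_right ?_ hpos.le
  have h1 := h n
  have h2 := h (-(n : ℤ) - 1)
  push_cast at h1 h2
  rw [abs_le]
  constructor <;> linarith [h1.1, h1.2, h2.1, h2.2]

lemma HasAngle.unique {x : ℤ → ℤ} {a b : ℝ} (ha : HasAngle x a) (hb : HasAngle x b) : a = b :=
  tendsto_nhds_unique ha hb

lemma hasAngle_rotationSeq (R : Rounding) (α s : ℝ) : HasAngle (rotationSeq R α s) α :=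
  (isBand_round R α s).hasAngle (isPrimitive_rotationSeq R α s)

/-- The primitive of a generalized Sturmian sequence of angle `α` is balanced: the rotation
sequences that agree with it on long intervals have angles close to `α`. -/
lemma balanced_of_mem_generalizedSturmianSeqs {x P : ℤ → ℤ} {α : ℝ}
    (hx : x ∈ generalizedSturmianSeqs) (hα : HasAngle x α) (hP : IsPrimitive x P) (n k : ℤ) :
    ((P n : ℝ) - n * α) - (P k - k * α) ≤ 1 := by
  let avg : ℕ → ℝ := fun N =>
    (∑ i ∈ Finset.Icc (-(N : ℤ)) (N : ℤ), (x i : ℝ)) / (2 * (N : ℝ) + 1)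
  have hlim : Tendsto (fun N : ℕ => 1 + |(n : ℝ) - k| *
      (|avg N - α| + 1 / (2 * (N : ℝ) + 1))) atTop (𝓝 (1 + |(n : ℝ) - k| * (0 + 0))) := by
    have h1 : Tendsto (fun N => |avg N - α|) atTop (𝓝 0) :=
      tendsto_iff_norm_sub_tendsto_zero.1 hα
    exact ((h1.add tendsto_inv_two_mul_add_one).const_mul _).const_add _
  rw [add_zero, mul_zero, add_zero] at hlim
  refine ge_of_tendsto hlim ?_
  filter_upwards [eventually_ge_atTop (n.natAbs + k.natAbs)] with N hN
  have hopen : IsOpen {z : ℤ → ℤ | ∀ i ∈ Finset.Icc (-(N : ℤ)) N, z i = x i} := by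
    have := isOpen_set_pi (i := ((Finset.Icc (-(N : ℤ)) N : Finset ℤ) : Set ℤ))
      (s := fun i => {x i}) (Finset.finite_toSet _) fun i _ => isOpen_discrete _
    exact this
  obtain ⟨z, hz, R, β, s, rfl⟩ := mem_closure_iff.1 hx _ hopen fun i _ => rfl
  have hz' : ∀ i, -(N : ℤ) ≤ i → i ≤ N → x i = rotationSeq R β s i := fun i h1 h2 =>
    (hz i (Finset.mem_Icc.2 ⟨h1, h2⟩)).symm
  have hband := isBand_round R β s
  have hprim := isPrimitive_rotationSeq R β s
  have hdiff : ∀ u v : ℤ, -(N : ℤ) - 1 ≤ u → u ≤ v → v ≤ N →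
      |(P v : ℝ) - P u - (v - u) * β| ≤ 1 := by
    intro u v hu huv hv
    have h1 := hP.sub_eq_sub hprim huv fun i hi hi' => hz' i (by omega) (by omega)
    have h2 : (P v : ℝ) - P u = R.round (v * β + s) - R.round (u * β + s) := by
      exact_mod_cast h1
    have h3 := hband v
    have h4 := hband u
    rw [h2, abs_le]
    constructor <;> linarith [h3.1, h3.2, h4.1, h4.2]
  have hpos : (0 : ℝ) < 2 * (N : ℝ) + 1 := by positivity
  have hβ : |β - α| ≤ |avg N - α| + 1 / (2 * (N : ℝ) + 1) := by
    have h1 : |avg N - β| ≤ 1 / (2 * (N : ℝ) + 1) := by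
      have h2 := hdiff (-(N : ℤ) - 1) N le_rfl (by omega) le_rfl
      simp only [avg]
      rw [hP.sum_Icc, div_sub' hpos.ne', abs_div, abs_of_pos hpos]
      refine div_le_div_of_nonneg_right ?_ hpos.le
      refine le_trans (le_of_eq ?_) h2
      congr 1
      push_cast
      ring
    have h3 : β - α = (avg N - α) - (avg N - β) := by ring
    rw [h3]
    exact (abs_sub _ _).trans (by linarith)
  have hmain : (P n : ℝ) - P k - (n - k) * β ≤ 1 := by
    rcases le_total k n with h | h
    · exact (abs_le.1 (hdiff k n (by omega) h (by omega))).2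
    · linarith [(abs_le.1 (hdiff n k (by omega) h (by omega))).1]
  have h5 : ((n : ℝ) - k) * (β - α) ≤ |(n : ℝ) - k| * |β - α| := by
    rw [← abs_mul]
    exact le_abs_self _
  have h6 := mul_le_mul_of_nonneg_left hβ (abs_nonneg ((n : ℝ) - k))
  linarith

lemma exists_isBand {x P : ℤ → ℤ} {α : ℝ}
    (hx : x ∈ generalizedSturmianSeqs) (hα : HasAngle x α) (hP : IsPrimitive x P) :
    ∃ τ, IsBand α τ P := by
  have h := balanced_of_mem_generalizedSturmianSeqs hx hα hP
  have hbdd : BddAbove (Set.range fun n : ℤ => (P n : ℝ) - n * α) :=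
    ⟨(P 0 : ℝ) - (0 : ℤ) * α + 1, by
      rintro _ ⟨n, rfl⟩
      linarith [h n 0]⟩
  refine ⟨⨆ n : ℤ, ((P n : ℝ) - n * α), fun n => ⟨?_, ?_⟩⟩
  · have : (⨆ k : ℤ, ((P k : ℝ) - k * α)) ≤ (P n : ℝ) - n * α + 1 :=
      ciSup_le fun k => by linarith [h k n]
    linarith
  · have := le_ciSup hbdd n
    beta_reduce at this
    linarith

lemma Irrational.exists_int_mul_add_mem {α : ℝ} (hα : Irrational α) {a b : ℝ} (hab : a < b) :
    ∃ n k : ℤ, a < n * α + k ∧ n * α + k < b := by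
  have hd : Dense (AddSubgroup.closure {α, 1} : Set ℝ) :=
    dense_addSubgroupClosure_pair_iff.2 (by rwa [div_one])
  obtain ⟨z, hz, h1, h2⟩ := hd.exists_between hab
  obtain ⟨n, k, rfl⟩ := AddSubgroup.mem_closure_pair.1 hz
  exact ⟨n, k, by simpa using h1, by simpa using h2⟩

namespace IsBand

/-- The signed heights of the points of a band over its upper line are dense in `[-1, 0]`. -/
lemma exists_mem {α τ a b : ℝ} {P : ℤ → ℤ} (h : IsBand α τ P) (hα : Irrational α)
    (ha : -1 ≤ a) (hab : a < b) (hb : b ≤ 0) :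
    ∃ n : ℤ, a < P n - (n * α + τ) ∧ P n - (n * α + τ) < b := by
  obtain ⟨n, k, h1, h2⟩ := hα.exists_int_mul_add_mem (show -b - τ < -a - τ by linarith)
  have h3 := h n
  have h4 : P n + k = 0 := by
    have h5 : ((P n + k : ℤ) : ℝ) < 1 := by
      push_cast
      linarith [h3.2]
    have h6 : (-1 : ℝ) < ((P n + k : ℤ) : ℝ) := by
      push_cast
      linarith [h3.1]
    have h5' : P n + k < 1 := by exact_mod_cast h5
    have h6' : -1 < P n + k := by exact_mod_cast h6
    omega
  have h7 : (P n : ℝ) + k = 0 := by exact_mod_cast h4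
  exact ⟨n, by linarith, by linarith⟩

/-- If a band arises from another by multiplication by `k` up to a carry in `[0, k - 1]`, then its
upper line is `k` times the other one. Close to its upper line the first band forces the
carry to vanish, close to its lower line it forces the carry to be `k - 1`. -/
lemma mul_step {α τ τ' : ℝ} {P P' ℓ : ℤ → ℤ} {k : ℕ} {c : ℤ} (hk : 0 < k) (hα : Irrational α)
    (h : IsBand α τ P) (h' : IsBand (k * α) τ' P') (hstep : ∀ n, P' n = k * P n + ℓ n + c)
    (hℓ : ∀ n, 0 ≤ ℓ n ∧ ℓ n ≤ (k : ℤ) - 1) : τ' = k * τ + c := by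
  have hk' : (0 : ℝ) < k := by exact_mod_cast hk
  have key : ∀ n : ℤ, (P' n : ℝ) - (n * (k * α) + τ')
      = k * (P n - (n * α + τ)) + ℓ n + (k * τ + c - τ') := by
    intro n
    rw [hstep n]
    push_cast
    ring
  by_contra hne
  rcases lt_or_gt_of_ne hne with hlt | hlt
  · obtain ⟨n, h1, h2⟩ := h.exists_mem hα (a := max (-1) (-(k * τ + c - τ') / k)) (b := 0)
      (le_max_left _ _) (max_lt (by norm_num) (div_neg_of_neg_of_pos (by linarith) hk')) le_rfl
    have h3 := (le_max_right _ _).trans_lt h1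
    rw [div_lt_iff₀ hk'] at h3
    have h4 : (0 : ℝ) ≤ ℓ n := by exact_mod_cast (hℓ n).1
    linarith [key n, (h' n).2]
  · obtain ⟨n, h1, h2⟩ := h.exists_mem hα (a := -1) (b := min 0 (-1 + (τ' - (k * τ + c)) / k))
      le_rfl (lt_min (by norm_num) (by linarith [div_pos (sub_pos.2 hlt) hk'])) (min_le_left _ _)
    have h3 := h2.trans_le (min_le_right _ _)
    have h5 : (P n - (n * α + τ) + 1) * k < τ' - (k * τ + c) := by
      rw [← lt_div_iff₀ hk']
      linarith
    have h4 : (ℓ n : ℝ) ≤ k - 1 := by exact_mod_cast (hℓ n).2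
    linarith [key n, (h' n).1]

lemma unique {α τ τ' : ℝ} {P : ℤ → ℤ} (hα : Irrational α) (h : IsBand α τ P)
    (h' : IsBand α τ' P) : τ' = τ := by
  have := mul_step (k := 1) (c := 0) (ℓ := 0) one_pos hα h (by simpa using h') (by simp) (by simp)
  simpa using this

lemma add_const {α τ : ℝ} {P : ℤ → ℤ} (h : IsBand α τ P) (c : ℤ) :
    IsBand α (τ + c) fun n => P n + c := fun n => by
  have := h n
  push_cast
  constructor <;> linarith

lemma eq_floor {α τ : ℝ} {P : ℤ → ℤ} (h : IsBand α τ P)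
    (h' : ∀ n : ℤ, (P n : ℝ) ≠ n * α + τ - 1) (n : ℤ) : P n = ⌊n * α + τ⌋ :=
  (Int.floor_eq_iff.2 ⟨(h n).2, by linarith [lt_of_le_of_ne (h n).1 (h' n).symm]⟩).symm

lemma eq_ceil {α τ : ℝ} {P : ℤ → ℤ} (h : IsBand α τ P)
    (h' : ∀ n : ℤ, (P n : ℝ) ≠ n * α + τ) (n : ℤ) : P n = ⌈n * α + τ⌉ - 1 := by
  have : ⌈n * α + τ⌉ = P n + 1 := by
    rw [Int.ceil_eq_iff]
    push_cast
    exact ⟨by linarith [lt_of_le_of_ne (h n).2 (h' n)], by linarith [(h n).1]⟩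
  omega

end IsBand

/-- The phase of a rotation sequence of irrational angle is determined modulo one. -/
lemma exists_phase_eq_add {R R' : Rounding} {α s s' : ℝ} (hα : Irrational α)
    (h : rotationSeq R α s = rotationSeq R' α s') : ∃ k : ℤ, s' = s + k := by
  have h1 := isPrimitive_rotationSeq R α s
  have h2 := isPrimitive_rotationSeq R' α s'
  rw [← h] at h2
  obtain ⟨c, hc⟩ := h1.exists_const h2
  have hb := (isBand_round R' α s').add_const c
  simp only [← hc] at hb
  have := (isBand_round R α s).unique hα hb
  refine ⟨R.offset - R'.offset - c, ?_⟩
  push_cast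
  linarith

/-- The carry of the multiplication by `k`: for the floor it is the number of `j < k`, `j ≠ 0`,
with `j / k ≤ fract x`. -/
def carry (R : Rounding) (k : ℕ) (x : ℝ) : ℤ :=
  R.round (k * x) - k * R.round x + (k - 1) * R.offset

lemma carry_nonneg (R : Rounding) {k : ℕ} (hk : 0 < k) (x : ℝ) : 0 ≤ carry R k x := by
  have hk' : (0 : ℝ) < k := by exact_mod_cast hk
  cases R
  · have h : (k : ℤ) * ⌊x⌋ ≤ ⌊(k : ℝ) * x⌋ := by
      rw [Int.le_floor]
      push_cast
      exact mul_le_mul_of_nonneg_left (Int.floor_le x) hk'.le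
    simp only [carry, Rounding.round, Rounding.offset]
    omega
  · have h : (k : ℤ) * ⌈x⌉ - k < ⌈(k : ℝ) * x⌉ := by
      rw [Int.lt_ceil]
      push_cast
      have := mul_lt_mul_of_pos_left (Int.ceil_lt_add_one x) hk'
      linarith
    simp only [carry, Rounding.round, Rounding.offset]
    omega

lemma carry_le (R : Rounding) {k : ℕ} (hk : 0 < k) (x : ℝ) : carry R k x ≤ k - 1 := by
  have hk' : (0 : ℝ) < k := by exact_mod_cast hk
  cases R
  · have h : ⌊(k : ℝ) * x⌋ < (k : ℤ) * ⌊x⌋ + k := by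
      rw [Int.floor_lt]
      push_cast
      have := mul_lt_mul_of_pos_left (Int.lt_floor_add_one x) hk'
      linarith
    simp only [carry, Rounding.round, Rounding.offset]
    omega
  · have h : ⌈(k : ℝ) * x⌉ ≤ (k : ℤ) * ⌈x⌉ := by
      rw [Int.ceil_le]
      push_cast
      exact mul_le_mul_of_nonneg_left (Int.le_ceil x) hk'.le
    simp only [carry, Rounding.round, Rounding.offset]
    omega

lemma carry_add_int (R : Rounding) (k : ℕ) (x : ℝ) (j : ℤ) :
    carry R k (x + j) = carry R k x := by
  have h : (k : ℝ) * (x + j) = k * x + ((k * j : ℤ) : ℝ) := by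
    push_cast
    ring
  simp only [carry, h, Rounding.round_add_int]
  ring

/-! ### The invertible skew product -/

/-- The part of the parameter space on which the skew product is invertible: the angle `2` is
omitted. -/
abbrev CoreSpace : Type := Set.Ico (1 / 3 : ℝ) 2 × solenoid

lemma CoreSpace.ext {p q : CoreSpace} (h1 : (p.1 : ℝ) = q.1) (h2 : p.2 = q.2) : p = q :=
  Prod.ext (Subtype.ext h1) h2

/-- The inclusion of the core in the parameter space. -/
def coreInclusion (p : CoreSpace) : ParamSpace := (⟨p.1, p.1.2.1, p.1.2.2.le⟩, p.2)

/-- The skew product on the parameter space, which never takes the angle `2`. -/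
def toCore (p : ParamSpace) : CoreSpace :=
  if h : (p.1 : ℝ) < 1 then
    (⟨2 * p.1, by have := p.1.2.1; constructor <;> linarith⟩, solenoidDouble p.2)
  else (⟨p.1 / 3, by have := p.1.2.2; constructor <;> linarith⟩, solenoidDivThree p.2)

lemma coreInclusion_toCore (p : ParamSpace) : coreInclusion (toCore p) = fHat p := by
  unfold toCore fHat angleMap coreInclusion
  split_ifs <;> rfl

/-- The inverse branch of the skew product: angles below `2 / 3` come from a division by three,
the others from a doubling. -/
def coreInv (p : CoreSpace) : CoreSpace :=
  if h : (p.1 : ℝ) < 2 / 3 then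
    (⟨3 * p.1, by have := p.1.2.1; constructor <;> linarith⟩, 3 • p.2)
  else (⟨p.1 / 2, by have := p.1.2.2; constructor <;> linarith⟩, 3 • divSixHom p.2)

lemma toCore_of_lt {p : ParamSpace} (h : (p.1 : ℝ) < 1) :
    ((toCore p).1 : ℝ) = 2 * p.1 ∧ (toCore p).2 = 2 • p.2 := by
  unfold toCore
  rw [dif_pos h]
  exact ⟨rfl, rfl⟩

lemma toCore_of_not_lt {p : ParamSpace} (h : ¬ (p.1 : ℝ) < 1) :
    ((toCore p).1 : ℝ) = p.1 / 3 ∧ (toCore p).2 = solenoidDivThree p.2 := by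
  unfold toCore
  rw [dif_neg h]
  exact ⟨rfl, rfl⟩

lemma coreInv_of_lt {p : CoreSpace} (h : (p.1 : ℝ) < 2 / 3) :
    ((coreInv p).1 : ℝ) = 3 * p.1 ∧ (coreInv p).2 = 3 • p.2 := by
  unfold coreInv
  rw [dif_pos h]
  exact ⟨rfl, rfl⟩

lemma coreInv_of_not_lt {p : CoreSpace} (h : ¬ (p.1 : ℝ) < 2 / 3) :
    ((coreInv p).1 : ℝ) = p.1 / 2 ∧ (coreInv p).2 = 3 • divSixHom p.2 := by
  unfold coreInv
  rw [dif_neg h]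
  exact ⟨rfl, rfl⟩

/-- The skew product as a permutation of the core. -/
def skew : Equiv.Perm CoreSpace where
  toFun p := toCore (coreInclusion p)
  invFun := coreInv
  left_inv p := by
    have h1 : 1 / 3 ≤ (p.1 : ℝ) := p.1.2.1
    have h2 : (p.1 : ℝ) < 2 := p.1.2.2
    by_cases h : (p.1 : ℝ) < 1
    · obtain ⟨ha, ht⟩ := toCore_of_lt (p := coreInclusion p) h
      change _ = 2 * (p.1 : ℝ) at ha
      obtain ⟨ha', ht'⟩ := coreInv_of_not_lt (p := toCore (coreInclusion p)) (by linarith)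
      refine CoreSpace.ext (by linarith) (two_nsmul_inj ?_)
      rw [ht', two_nsmul_three_nsmul_divSixHom, ht]
      rfl
    · obtain ⟨ha, ht⟩ := toCore_of_not_lt (p := coreInclusion p) h
      change _ = (p.1 : ℝ) / 3 at ha
      obtain ⟨ha', ht'⟩ := coreInv_of_lt (p := toCore (coreInclusion p)) (by linarith)
      refine CoreSpace.ext (by linarith) ?_
      rw [ht', ht, three_nsmul_solenoidDivThree]
      rfl
  right_inv p := by
    have h1 : 1 / 3 ≤ (p.1 : ℝ) := p.1.2.1
    have h2 : (p.1 : ℝ) < 2 := p.1.2.2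
    by_cases h : (p.1 : ℝ) < 2 / 3
    · obtain ⟨ha, ht⟩ := coreInv_of_lt h
      have h3 : ¬ ((coreInclusion (coreInv p)).1 : ℝ) < 1 := by
        change ¬ ((coreInv p).1 : ℝ) < 1
        linarith
      obtain ⟨ha', ht'⟩ := toCore_of_not_lt h3
      change _ = ((coreInv p).1 : ℝ) / 3 at ha'
      refine CoreSpace.ext (by linarith) (three_nsmul_inj ?_)
      rw [ht', three_nsmul_solenoidDivThree]
      exact ht
    · obtain ⟨ha, ht⟩ := coreInv_of_not_lt h
      have h3 : ((coreInclusion (coreInv p)).1 : ℝ) < 1 := by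
        change ((coreInv p).1 : ℝ) < 1
        linarith
      obtain ⟨ha', ht'⟩ := toCore_of_lt h3
      change _ = 2 * ((coreInv p).1 : ℝ) at ha'
      refine CoreSpace.ext (by linarith) ?_
      rw [ht', ← two_nsmul_three_nsmul_divSixHom p.2, ← ht]
      rfl

lemma coreInclusion_skew (p : CoreSpace) : coreInclusion (skew p) = fHat (coreInclusion p) :=
  coreInclusion_toCore _

lemma skew_fst_of_lt {p : CoreSpace} (h : (p.1 : ℝ) < 1) : ((skew p).1 : ℝ) = 2 * p.1 :=
  (toCore_of_lt (p := coreInclusion p) h).1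

lemma skew_snd_of_lt {p : CoreSpace} (h : (p.1 : ℝ) < 1) : (skew p).2 = 2 • p.2 :=
  (toCore_of_lt (p := coreInclusion p) h).2

lemma skew_fst_of_not_lt {p : CoreSpace} (h : ¬ (p.1 : ℝ) < 1) :
    ((skew p).1 : ℝ) = p.1 / 3 :=
  (toCore_of_not_lt (p := coreInclusion p) h).1

lemma three_nsmul_skew_snd {p : CoreSpace} (h : ¬ (p.1 : ℝ) < 1) : 3 • (skew p).2 = p.2 := by
  have : (skew p).2 = solenoidDivThree p.2 := (toCore_of_not_lt (p := coreInclusion p) h).2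
  rw [this, three_nsmul_solenoidDivThree]

/-- The rotation `(α, t) ↦ (α, t + α)`. -/
def rot : Equiv.Perm CoreSpace where
  toFun p := (p.1, p.2 + solenoidOfReal p.1)
  invFun p := (p.1, p.2 - solenoidOfReal p.1)
  left_inv p := by simp
  right_inv p := by simp

lemma toCore_add (α : Set.Icc (1 / 3 : ℝ) 2) (t : solenoid) :
    toCore (α, t + solenoidOfReal α) = rot (toCore (α, t)) := by
  by_cases h : (α : ℝ) < 1
  · simp only [toCore, h, dif_pos, rot, Equiv.coe_fn_mk, solenoidDouble, nsmul_add,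
      nsmul_solenoidOfReal]
    rfl
  · simp only [toCore, h, dif_neg, rot, Equiv.coe_fn_mk, solenoidDivThree_add,
      solenoidDivThree_ofReal, not_false_eq_true]

lemma commute_skew_rot : Commute skew rot := by
  ext1 p
  exact toCore_add _ _

lemma rot_zpow_apply (n : ℤ) (p : CoreSpace) :
    (rot ^ n) p = (p.1, p.2 + n • solenoidOfReal p.1) := by
  induction n with
  | zero => simp
  | succ n ih =>
    rw [add_comm, zpow_add, zpow_one, Equiv.Perm.mul_apply, ih]
    simp only [rot, Equiv.coe_fn_mk, add_assoc, add_zsmul, one_zsmul]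
    rw [add_comm (solenoidOfReal _)]
  | pred n ih =>
    rw [sub_eq_add_neg, add_comm, zpow_add, zpow_neg_one, Equiv.Perm.mul_apply, ih]
    simp only [rot, Equiv.Perm.inv_def, Equiv.coe_fn_symm_mk, add_zsmul, neg_one_zsmul]
    rw [add_comm (-solenoidOfReal _), ← add_assoc, sub_eq_add_neg]

/-! ### The tiling of a point of the skew product -/

/-- A real number representing the base phase of a solenoid point. -/
def phase (t : solenoid) : ℝ := Function.surjInv QuotientAddGroup.mk_surjective (basePhase t)

lemma coe_phase (t : solenoid) : (phase t : AddCircle ((6 : ℝ) ^ 0)) = basePhase t :=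
  Function.surjInv_eq _ _

lemma exists_eq_add_int {x y : ℝ}
    (h : (x : AddCircle ((6 : ℝ) ^ 0)) = (y : AddCircle ((6 : ℝ) ^ 0))) :
    ∃ k : ℤ, y = x + k := by
  simpa using (coe_eq_coe_iff 0 x y).1 h

/-- The label of a horizontal edge with value `v`, given whether the tile below it has type `2`. -/
def edgeV (prime : Bool) (v : ℤ) : VLabel :=
  if v = 0 then (if prime then .zeroPrime else .zero) else if v = 1 then .one else .two

/-- The label of a vertical edge with carry `c`, in a row of type `1/3` or of type `2`. On the
labels of type `1/3` the carry is three times the label, on those of type `2` it is minus the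
label. -/
def edgeH (third : Bool) (c : ℤ) : HLabel :=
  if third then (if c = 0 then .zeroThirds else if c = 1 then .oneThird else .twoThirds)
  else if c = 0 then .zero else .negOne

lemma tile_mem_of_doubling {prime : Bool} {b l t r : ℤ} (h : 2 * b + r = t + l)
    (hb : 0 ≤ b ∧ b ≤ 1) (hl : 0 ≤ l ∧ l ≤ 1) (ht : 0 ≤ t ∧ t ≤ 2) (hr : 0 ≤ r ∧ r ≤ 1)
    (hp : prime = true → 1 ≤ t) :
    (⟨edgeV prime b, edgeH false l, edgeV true t, edgeH false r⟩ : WangTile)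
      ∈ kariCulikTiles := by
  obtain ⟨hb0, hb1⟩ := hb
  obtain ⟨hl0, hl1⟩ := hl
  obtain ⟨hr0, hr1⟩ := hr
  obtain rfl : t = 2 * b + r - l := by omega
  interval_cases b <;> interval_cases l <;> interval_cases r <;> cases prime <;>
    simp_all [edgeV, edgeH, kariCulikTiles]

lemma tile_mem_of_thirding {prime : Bool} {b l t r : ℤ} (h : b + l = 3 * t + r)
    (hb : 1 ≤ b ∧ b ≤ 2) (hl : 0 ≤ l ∧ l ≤ 2) (ht : 0 ≤ t ∧ t ≤ 1) (hr : 0 ≤ r ∧ r ≤ 2) :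
    (⟨edgeV prime b, edgeH true l, edgeV false t, edgeH true r⟩ : WangTile)
      ∈ kariCulikTiles := by
  obtain ⟨ht0, ht1⟩ := ht
  obtain ⟨hl0, hl1⟩ := hl
  obtain ⟨hr0, hr1⟩ := hr
  obtain rfl : b = 3 * t + r - l := by omega
  interval_cases t <;> interval_cases l <;> interval_cases r <;>
    first
      | omega
      | simp [edgeV, edgeH, kariCulikTiles]

/-- The value at the bottom of the tile of `p`. -/
def bottomValue (R : Rounding) (p : CoreSpace) : ℤ :=
  R.round (phase p.2) - R.round (phase p.2 - p.1)

lemma bottomValue_eq (R : Rounding) (p : CoreSpace) {x : ℝ}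
    (hx : (x : AddCircle ((6 : ℝ) ^ 0)) = basePhase p.2) :
    bottomValue R p = R.round x - R.round (x - p.1) := by
  obtain ⟨k, hk⟩ := exists_eq_add_int (hx.trans (coe_phase _).symm)
  rw [bottomValue, hk, add_sub_right_comm, R.round_add_int, R.round_add_int]
  ring

/-- The bottom label of the tile of `p`. -/
def bottomEdge (R : Rounding) (p : CoreSpace) : VLabel :=
  edgeV (decide (2 / 3 ≤ (p.1 : ℝ))) (bottomValue R p)

/-- The right label of the tile of `p`. -/
def sideEdge (R : Rounding) (p : CoreSpace) : HLabel :=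
  if (p.1 : ℝ) < 1 then edgeH false (carry R 2 (phase p.2))
  else edgeH true (carry R 3 (phase (skew p).2))

lemma sideEdge_of_lt (R : Rounding) {p : CoreSpace} (h : (p.1 : ℝ) < 1) {x : ℝ}
    (hx : (x : AddCircle ((6 : ℝ) ^ 0)) = basePhase p.2) :
    sideEdge R p = edgeH false (carry R 2 x) := by
  obtain ⟨k, hk⟩ := exists_eq_add_int (hx.trans (coe_phase _).symm)
  rw [sideEdge, if_pos h, hk, carry_add_int]

lemma sideEdge_of_not_lt (R : Rounding) {p : CoreSpace} (h : ¬ (p.1 : ℝ) < 1) {x : ℝ}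
    (hx : (x : AddCircle ((6 : ℝ) ^ 0)) = basePhase (skew p).2) :
    sideEdge R p = edgeH true (carry R 3 x) := by
  obtain ⟨k, hk⟩ := exists_eq_add_int (hx.trans (coe_phase _).symm)
  rw [sideEdge, if_neg h, hk, carry_add_int]

/-- The tile of the point `p` of the skew product. -/
def tileOf (R : Rounding) (p : CoreSpace) : WangTile :=
  ⟨bottomEdge R p, sideEdge R (rot⁻¹ p), bottomEdge R (skew p), sideEdge R p⟩

lemma bottomValue_bounds (R : Rounding) (p : CoreSpace) :
    (bottomValue R p : ℝ) < p.1 + 1 ∧ (p.1 : ℝ) - 1 < bottomValue R p := by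
  have h1 := R.round_sub_round_lt (phase p.2) (phase p.2 - p.1)
  have h2 := R.round_sub_round_lt (phase p.2 - p.1) (phase p.2)
  rw [bottomValue]
  push_cast
  constructor <;> linarith

lemma bottomValue_mem (R : Rounding) (p : CoreSpace) :
    0 ≤ bottomValue R p ∧ bottomValue R p ≤ 2 := by
  obtain ⟨h1, h2⟩ := bottomValue_bounds R p
  have h3 := p.1.2.1
  have h4 := p.1.2.2
  constructor
  · have : (-1 : ℝ) < bottomValue R p := by linarith
    have : (-1 : ℤ) < bottomValue R p := by exact_mod_cast this
    omega
  · have : (bottomValue R p : ℝ) < 3 := by linarith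
    have : bottomValue R p < 3 := by exact_mod_cast this
    omega

lemma bottomValue_le_one (R : Rounding) {p : CoreSpace} (h : (p.1 : ℝ) ≤ 1) :
    bottomValue R p ≤ 1 := by
  have h1 : (bottomValue R p : ℝ) < 2 := by linarith [(bottomValue_bounds R p).1]
  have h2 : bottomValue R p < 2 := by exact_mod_cast h1
  omega

lemma one_le_bottomValue (R : Rounding) {p : CoreSpace} (h : 1 ≤ (p.1 : ℝ)) :
    1 ≤ bottomValue R p := by
  have h1 : (0 : ℝ) < bottomValue R p := by linarith [(bottomValue_bounds R p).2]
  have h2 : 0 < bottomValue R p := by exact_mod_cast h1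
  omega

lemma value_edgeV {prime : Bool} {v : ℤ} (h : 0 ≤ v ∧ v ≤ 2) : (edgeV prime v).value = v := by
  obtain ⟨h1, h2⟩ := h
  interval_cases v <;> cases prime <;> simp [edgeV, VLabel.value]

lemma coe_sub_eq {x a : ℝ} {t : solenoid} (hx : (x : AddCircle ((6 : ℝ) ^ 0)) = basePhase t) :
    ((x - a : ℝ) : AddCircle ((6 : ℝ) ^ 0)) = basePhase (t - solenoidOfReal a) := by
  rw [map_sub, ← hx, basePhase_solenoidOfReal]
  rfl

lemma coe_nsmul_eq (k : ℕ) {x : ℝ} {t : solenoid}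
    (hx : (x : AddCircle ((6 : ℝ) ^ 0)) = basePhase t) :
    ((k * x : ℝ) : AddCircle ((6 : ℝ) ^ 0)) = basePhase (k • t) := by
  rw [map_nsmul, ← hx, ← AddCircle.coe_nsmul, nsmul_eq_mul]

lemma tileOf_mem (R : Rounding) (p : CoreSpace) : tileOf R p ∈ kariCulikTiles := by
  have h1 := p.1.2.1
  have h2 := p.1.2.2
  have hcomm : skew (rot⁻¹ p) = rot⁻¹ (skew p) :=
    congrArg (fun e : Equiv.Perm CoreSpace => e p) commute_skew_rot.inv_right.eq
  by_cases h : (p.1 : ℝ) < 1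
  · have hx := coe_phase p.2
    have hx2 := coe_nsmul_eq 2 hx
    rw [← skew_snd_of_lt h] at hx2
    have ht := bottomValue_eq R (skew p) hx2
    have hs := skew_fst_of_lt h
    have hl : sideEdge R (rot⁻¹ p) = edgeH false (carry R 2 (phase p.2 - p.1)) :=
      sideEdge_of_lt R (p := rot⁻¹ p) h (coe_sub_eq hx)
    have hr := sideEdge_of_lt R h hx
    have htrue : decide (2 / 3 ≤ ((skew p).1 : ℝ)) = true := by
      rw [hs, decide_eq_true_eq]
      linarith
    rw [tileOf, hl, hr, bottomEdge, bottomEdge, htrue]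
    refine tile_mem_of_doubling ?_ ⟨(bottomValue_mem R p).1, bottomValue_le_one R h.le⟩
      ⟨carry_nonneg R two_pos _, by simpa using carry_le R two_pos (phase p.2 - p.1)⟩
      (bottomValue_mem R _)
      ⟨carry_nonneg R two_pos _, by simpa using carry_le R two_pos (phase p.2)⟩ fun hp => ?_
    · rw [ht, bottomValue, hs, carry, carry]
      push_cast
      rw [show (2 : ℝ) * (phase p.2 - p.1) = 2 * phase p.2 - 2 * p.1 by ring]
      ring
    · refine one_le_bottomValue R ?_
      rw [decide_eq_true_eq] at hp
      rw [hs]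
      linarith
  · have hx := coe_phase (skew p).2
    have hx3 := coe_nsmul_eq 3 hx
    rw [three_nsmul_skew_snd h] at hx3
    have hb := bottomValue_eq R p hx3
    have hs := skew_fst_of_not_lt h
    have hl : sideEdge R (rot⁻¹ p) = edgeH true (carry R 3 (phase (skew p).2 - (skew p).1)) := by
      refine sideEdge_of_not_lt R (p := rot⁻¹ p) h ?_
      rw [hcomm]
      exact coe_sub_eq hx
    have hr := sideEdge_of_not_lt R h hx
    have hfalse : decide (2 / 3 ≤ ((skew p).1 : ℝ)) = false := by
      rw [hs, decide_eq_false_iff_not]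
      linarith
    rw [tileOf, hl, hr, bottomEdge, bottomEdge, hfalse]
    refine tile_mem_of_thirding ?_ ⟨one_le_bottomValue R (not_lt.1 h), (bottomValue_mem R p).2⟩
      ⟨carry_nonneg R three_pos _, by
        simpa using carry_le R three_pos (phase (skew p).2 - (skew p).1)⟩
      ⟨(bottomValue_mem R _).1, bottomValue_le_one R (by rw [hs]; linarith)⟩
      ⟨carry_nonneg R three_pos _, by simpa using carry_le R three_pos (phase (skew p).2)⟩
    rw [hb, bottomValue, carry, carry]
    push_cast
    rw [show (3 : ℝ) * (phase (skew p).2 - (skew p).1) = 3 * phase (skew p).2 - p.1 by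
      rw [hs]; ring]
    ring

/-- The tiling of the point `p` of the skew product. -/
def tilingOf (R : Rounding) (p : CoreSpace) : Configuration :=
  fun m n => tileOf R ((skew ^ m) ((rot ^ n) p))

lemma skew_zpow_rot_zpow (m n : ℤ) (p : CoreSpace) :
    (skew ^ m) ((rot ^ n) p) = (rot ^ n) ((skew ^ m) p) :=
  congrArg (fun e : Equiv.Perm CoreSpace => e p) (commute_skew_rot.zpow_zpow m n).eq

lemma zpow_add_one_apply {X : Type*} (e : Equiv.Perm X) (m : ℤ) (p : X) :
    (e ^ (m + 1)) p = e ((e ^ m) p) := by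
  rw [add_comm, zpow_add, zpow_one, Equiv.Perm.mul_apply]

lemma isKariCulikTiling_tilingOf (R : Rounding) (p : CoreSpace) :
    IsKariCulikTiling (tilingOf R p) := by
  refine ⟨fun m n => tileOf_mem R _, fun m n => ?_, fun m n => ?_⟩
  · simp only [tilingOf, tileOf]
    rw [skew_zpow_rot_zpow, skew_zpow_rot_zpow, zpow_add_one_apply,
      Equiv.Perm.inv_def, Equiv.symm_apply_apply]
  · simp only [tilingOf, tileOf]
    rw [zpow_add_one_apply]

/-- The rows of bottom labels are the rotation sequences of the orbit under the skew product. -/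
lemma bottomLabels_tilingOf (R : Rounding) (p : CoreSpace) (m : ℤ) {s : ℝ}
    (hs : (s : AddCircle ((6 : ℝ) ^ 0)) = basePhase ((skew ^ m) p).2) :
    bottomLabels (tilingOf R p) m = rotationSeq R ((skew ^ m) p).1 s := by
  funext n
  simp only [bottomLabels, tilingOf, tileOf, bottomEdge]
  rw [value_edgeV (bottomValue_mem R _), skew_zpow_rot_zpow, rot_zpow_apply]
  rw [bottomValue_eq R _ (x := n * ((skew ^ m) p).1 + s), rotationSeq]
  · congr 2
    ring
  · rw [map_add, zsmul_solenoidOfReal, basePhase_solenoidOfReal, ← hs, add_comm, AddCircle.coe_add]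

lemma tilingOf_mem_KC (R : Rounding) (p : CoreSpace) : tilingOf R p ∈ KC :=
  ⟨isKariCulikTiling_tilingOf R p, fun m => subset_closure
    ⟨R, _, _, bottomLabels_tilingOf R p m (coe_phase _)⟩⟩

lemma tilingOf_rot (R : Rounding) (p : CoreSpace) :
    tilingOf R (rot p) = shiftT (tilingOf R p) := by
  funext m n
  simp only [tilingOf, shiftT, zpow_add, zpow_one, Equiv.Perm.mul_apply]

lemma tilingOf_skew (R : Rounding) (p : CoreSpace) :
    tilingOf R (skew p) = shiftS (tilingOf R p) := by
  funext m n
  simp only [tilingOf, shiftS]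
  rw [skew_zpow_rot_zpow, skew_zpow_rot_zpow, zpow_add, zpow_one, Equiv.Perm.mul_apply]

lemma fst_skew_zpow_congr (m : ℤ) {p q : CoreSpace} (h : p.1 = q.1) :
    ((skew ^ m) p).1 = ((skew ^ m) q).1 := by
  have h1 : ∀ p q : CoreSpace, p.1 = q.1 → (skew p).1 = (skew q).1 := by
    intro p q h
    refine Subtype.ext ?_
    by_cases hq : (q.1 : ℝ) < 1
    · rw [skew_fst_of_lt (h ▸ hq), skew_fst_of_lt hq, h]
    · rw [skew_fst_of_not_lt (h ▸ hq), skew_fst_of_not_lt hq, h]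
  have h2 : ∀ p q : CoreSpace, p.1 = q.1 → (coreInv p).1 = (coreInv q).1 := by
    intro p q h
    refine Subtype.ext ?_
    by_cases hq : (q.1 : ℝ) < 2 / 3
    · rw [(coreInv_of_lt (h ▸ hq)).1, (coreInv_of_lt hq).1, h]
    · rw [(coreInv_of_not_lt (h ▸ hq)).1, (coreInv_of_not_lt hq).1, h]
  induction m with
  | zero => exact h
  | succ m ih => rw [zpow_add_one_apply, zpow_add_one_apply]; exact h1 _ _ ih
  | pred m ih =>
    rw [sub_eq_add_neg, add_comm, zpow_add, zpow_neg_one, Equiv.Perm.mul_apply,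
      Equiv.Perm.mul_apply]
    exact h2 _ _ ih

lemma irrational_skew_fst (p : CoreSpace) :
    Irrational ((skew p).1 : ℝ) ↔ Irrational (p.1 : ℝ) := by
  by_cases h : (p.1 : ℝ) < 1
  · rw [skew_fst_of_lt h]
    exact_mod_cast (irrational_natCast_mul_iff (n := 2) (x := (p.1 : ℝ))).trans (by simp)
  · rw [skew_fst_of_not_lt h]
    exact_mod_cast (irrational_div_natCast_iff (n := 3) (x := (p.1 : ℝ))).trans (by simp)

lemma irrational_skew_zpow_fst (m : ℤ) (p : CoreSpace) :
    Irrational (((skew ^ m) p).1 : ℝ) ↔ Irrational (p.1 : ℝ) := by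
  induction m with
  | zero => rfl
  | succ m ih => rw [zpow_add_one_apply, irrational_skew_fst, ih]
  | pred m ih =>
    rw [← ih, ← irrational_skew_fst, ← zpow_add_one_apply, sub_add_cancel]

/-- The step from the row of angle `a m` is a doubling when `a m < 1`. Two successive angles
in `[1, 2)` are impossible, and so are three successive angles in `[1/3, 1)`. -/
lemma isAdmissible_of_angles {a : ℤ → ℝ} (h1 : ∀ m, 1 / 3 ≤ a m ∧ a m < 2)
    (h2 : ∀ m, a m < 1 → a (m + 1) = 2 * a m) (h3 : ∀ m, ¬ a m < 1 → a (m + 1) = a m / 3) :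
    IsAdmissible fun m => a m < 1 := by
  refine fun m => ⟨?_, ?_⟩
  · by_cases h : a m < 1
    · exact Or.inl h
    · refine Or.inr ?_
      beta_reduce
      rw [h3 m h]
      linarith [(h1 m).2]
  · rintro ⟨h4, h5, h6⟩
    rw [show m + 2 = m + 1 + 1 by ring, h2 _ h5, h2 _ h4] at h6
    linarith [(h1 m).1]

lemma isStepSeq_skew (p : CoreSpace) :
    IsStepSeq (fun m => (((skew ^ m) p).1 : ℝ) < 1) fun m => ((skew ^ m) p).2 := by
  refine fun m => ⟨fun h => ?_, fun h => ?_⟩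
  · simp only [zpow_add_one_apply]
    exact skew_snd_of_lt h
  · simp only [zpow_add_one_apply]
    exact three_nsmul_skew_snd h

lemma isAdmissible_skew (p : CoreSpace) :
    IsAdmissible fun m => (((skew ^ m) p).1 : ℝ) < 1 :=
  isAdmissible_of_angles (a := fun m => (((skew ^ m) p).1 : ℝ)) (fun m => ((skew ^ m) p).1.2)
    (fun m h => by simp only [zpow_add_one_apply]; exact skew_fst_of_lt h)
    (fun m h => by simp only [zpow_add_one_apply]; exact skew_fst_of_not_lt h)

/-- A point of the skew product is determined by its angle and the base phases of its orbit: the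
step sequence of the differences vanishes after multiplication by `6 ^ j`, hence vanishes. -/
lemma eq_of_basePhase_eq {p q : CoreSpace} (h1 : p.1 = q.1)
    (h2 : ∀ m : ℤ, basePhase ((skew ^ m) p).2 = basePhase ((skew ^ m) q).2) : p = q := by
  refine Prod.ext h1 (solenoid_ext fun j => ?_)
  have hq := isStepSeq_skew q
  simp only [← fst_skew_zpow_congr _ h1] at hq
  have hsub := (isStepSeq_skew p).sub hq
  have h0 := IsStepSeq.eq_zero_of_six_pow (isAdmissible_skew p) j (hsub.map (sixthPhase j))
    (fun m => by rw [six_pow_nsmul_sixthPhase, map_sub, h2, sub_self]) 0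
  rw [map_sub, sub_eq_zero] at h0
  exact h0

/-- Over irrational angles, a point of the skew product is determined by its tiling. -/
lemma tilingOf_injective {R R' : Rounding} {p q : CoreSpace} (hp : Irrational (p.1 : ℝ))
    (h : tilingOf R p = tilingOf R' q) : p = q := by
  have hrow : ∀ m : ℤ, rotationSeq R ((skew ^ m) p).1 (phase ((skew ^ m) p).2)
      = rotationSeq R' ((skew ^ m) q).1 (phase ((skew ^ m) q).2) := fun m => by
    rw [← bottomLabels_tilingOf R p m (coe_phase _), h, bottomLabels_tilingOf R' q m (coe_phase _)]
  have h1 : p.1 = q.1 := by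
    have h0 := hasAngle_rotationSeq R ((skew ^ (0 : ℤ)) p).1 (phase ((skew ^ (0 : ℤ)) p).2)
    rw [hrow 0] at h0
    exact Subtype.ext (h0.unique (hasAngle_rotationSeq R' _ _))
  refine eq_of_basePhase_eq h1 fun m => ?_
  have hm := hrow m
  rw [← fst_skew_zpow_congr m h1] at hm
  obtain ⟨k, hk⟩ := exists_phase_eq_add ((irrational_skew_zpow_fst m p).2 hp) hm
  rw [← coe_phase, ← coe_phase]
  exact (coe_eq_coe_iff 0 _ _).2 ⟨k, by simpa using hk⟩

lemma tilingOf_mem_KCirr (R : Rounding) {p : CoreSpace} (hp : Irrational (p.1 : ℝ)) :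
    tilingOf R p ∈ KCirr :=
  ⟨tilingOf_mem_KC R p, fun m => ⟨_, (irrational_skew_zpow_fst m p).2 hp, by
    rw [bottomLabels_tilingOf R p m (coe_phase _)]
    exact hasAngle_rotationSeq R _ _⟩⟩

/-! ### Orbits with prescribed base phases -/

lemma skew_zpow_eq {p : ℤ → CoreSpace} (h : ∀ m, skew (p m) = p (m + 1)) (m : ℤ) :
    (skew ^ m) (p 0) = p m := by
  induction m with
  | zero => rfl
  | succ m ih => rw [zpow_add_one_apply, ih, h]
  | pred m ih =>
    apply skew.injective
    rw [← zpow_add_one_apply, h, sub_add_cancel, ih]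

/-- Every step sequence of phases is the sequence of base phases of an orbit: its sixth parts
provide the remaining coordinates. -/
lemma exists_orbit {a : ℤ → ℝ} (h1 : ∀ m, 1 / 3 ≤ a m ∧ a m < 2)
    (h2 : ∀ m, a m < 1 → a (m + 1) = 2 * a m) (h3 : ∀ m, ¬ a m < 1 → a (m + 1) = a m / 3)
    {σ : ℤ → AddCircle ((6 : ℝ) ^ 0)} (hσ : IsStepSeq (fun m => a m < 1) σ) :
    ∃ p : ℤ → CoreSpace, (∀ m, ((p m).1 : ℝ) = a m) ∧ (∀ m, basePhase (p m).2 = σ m) ∧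
      ∀ m, (skew ^ m) (p 0) = p m := by
  obtain ⟨X, hX0, hX, hX6⟩ := hσ.exists_six_tower (isAdmissible_of_angles h1 h2 h3)
  choose t ht using fun m => exists_solenoid (fun j => X j m) fun j => hX6 j m
  refine ⟨fun m => (⟨a m, h1 m⟩, t m), fun m => rfl, fun m => (ht m 0).trans (congrFun hX0 m),
    skew_zpow_eq (p := fun m => (⟨a m, h1 m⟩, t m)) fun m => ?_⟩
  by_cases h : a m < 1
  · refine CoreSpace.ext ((skew_fst_of_lt h).trans (h2 m h).symm)
      ((skew_snd_of_lt h).trans (solenoid_ext fun j => ?_))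
    rw [map_nsmul, ht, ht, ((hX j) m).1 h]
  · refine CoreSpace.ext ((skew_fst_of_not_lt h).trans (h3 m h).symm)
      (three_nsmul_inj ((three_nsmul_skew_snd h).trans (solenoid_ext fun j => ?_)))
    rw [map_nsmul, ht, ht, ((hX j) m).2 h]

/-! ### A common rounding for all rows -/

/-- Models, along one column, the signed height `e m` of the primitive of row `m` over the upper
line of its band: a doubling step doubles it and adds a carry, and after the inverse of a tripling
the old height is three times the new one plus a carry. -/
structure IsHeightSeq (d : ℤ → Prop) (e : ℤ → ℝ) (ℓ : ℤ → ℤ) : Prop where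
  mem : ∀ m, -1 ≤ e m ∧ e m ≤ 0
  double : ∀ m, d m → e (m + 1) = 2 * e m + ℓ m ∧ 0 ≤ ℓ m ∧ ℓ m ≤ 1
  third : ∀ m, ¬ d m → e m = 3 * e (m + 1) + ℓ m ∧ 0 ≤ ℓ m ∧ ℓ m ≤ 2

namespace IsHeightSeq

variable {d : ℤ → Prop} {e : ℤ → ℝ} {ℓ : ℤ → ℤ}

lemma rational_of_le (h : IsHeightSeq d e ℓ) {m m' : ℤ} (hm : m ≤ m') {i : ℤ} (hi : e m = i) :
    ∃ N : ℕ, N ≠ 0 ∧ ∃ j : ℤ, N * e m' = j := by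
  induction m', hm using Int.leInduction with
  | base => exact ⟨1, one_ne_zero, i, by simpa using hi⟩
  | succ k _ ih =>
    obtain ⟨N, hN, j, hj⟩ := ih
    by_cases hd : d k
    · refine ⟨N, hN, 2 * j + N * ℓ k, ?_⟩
      rw [(h.double k hd).1]
      push_cast
      rw [← hj]
      ring
    · refine ⟨3 * N, by omega, j - N * ℓ k, ?_⟩
      have h1 := (h.third k hd).1
      push_cast
      rw [← hj, h1]
      ring

/-- Before an integral height all heights are dyadic. -/
lemma dyadic_of_le (h : IsHeightSeq d e ℓ) {m m' : ℤ} (hm : m ≤ m') {i : ℤ} (hi : e m' = i) :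
    ∃ (s : ℕ) (j : ℤ), 2 ^ s * e m = j := by
  induction m, hm using Int.leInductionDown with
  | base => exact ⟨0, i, by simpa using hi⟩
  | pred k _ ih =>
    obtain ⟨s, j, hj⟩ := ih
    by_cases hd : d (k - 1)
    · have h1 := (h.double (k - 1) hd).1
      rw [sub_add_cancel] at h1
      refine ⟨s + 1, j - 2 ^ s * ℓ (k - 1), ?_⟩
      push_cast
      rw [← hj, h1]
      ring
    · have h1 := (h.third (k - 1) hd).1
      rw [sub_add_cancel] at h1
      refine ⟨s, 3 * j + 2 ^ s * ℓ (k - 1), ?_⟩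
      push_cast
      rw [← hj, h1]
      ring

/-- Two integral heights of a column agree: between them all heights are dyadic, so an inverse
tripling, which would introduce a denominator `3`, cannot leave the integers. -/
lemma eq_of_le (h : IsHeightSeq d e ℓ) {m m' : ℤ} (hm : m ≤ m') {i i' : ℤ}
    (hi : e m = i) (hi' : e m' = i') : i = i' := by
  have key : ∀ k, m ≤ k → k ≤ m' → e k = i := by
    intro k hk
    induction k, hk using Int.leInduction with
    | base => exact fun _ => hi
    | succ k hk ih =>
      intro hk'
      have hek := ih (by omega)
      have hi0 : -1 ≤ i ∧ i ≤ 0 := by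
        have := h.mem k
        rw [hek] at this
        exact_mod_cast this
      have hmem := h.mem (k + 1)
      by_cases hd : d k
      · obtain ⟨h1, h2, h3⟩ := h.double k hd
        rw [hek] at h1
        have h4 : e (k + 1) = ((2 * i + ℓ k : ℤ) : ℝ) := by
          rw [h1]
          push_cast
          ring
        rw [h4] at hmem ⊢
        have h5 : -1 ≤ 2 * i + ℓ k ∧ 2 * i + ℓ k ≤ 0 := by exact_mod_cast hmem
        have h6 : 2 * i + ℓ k = i := by omega
        rw [h6]
      · obtain ⟨h1, h2, h3⟩ := h.third k hd
        rw [hek] at h1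
        obtain ⟨s, j, hj⟩ := h.dyadic_of_le hk' hi'
        have h4 : 2 ^ s * (i - ℓ k) = 3 * j := by
          have : (2 : ℝ) ^ s * (i - ℓ k) = 3 * j := by
            rw [← hj, h1]
            ring
          exact_mod_cast this
        have h5 : (3 : ℤ) ∣ i - ℓ k := by
          refine IsCoprime.dvd_of_dvd_mul_left (IsCoprime.pow_right (n := s) ?_) ⟨j, h4⟩
          exact ⟨1, -1, by norm_num⟩
        have h6 : i - ℓ k = 3 * i := by omega
        have h7 : (i : ℝ) - ℓ k = 3 * i := by exact_mod_cast h6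
        linarith
  have h1 := key m' hm le_rfl
  rw [hi'] at h1
  exact_mod_cast h1.symm

end IsHeightSeq

/-- The decoded rows of a tiling: row `m` has angle `a m`, primitive `P m`, upper line of
height `τ m`, and the carries `ℓ m`. -/
structure IsDecoding (a τ : ℤ → ℝ) (P ℓ : ℤ → ℤ → ℤ) (c : ℤ → ℤ) : Prop where
  irrational : ∀ m, Irrational (a m)
  band : ∀ m, IsBand (a m) (τ m) (P m)
  double : ∀ m, a m < 1 → a (m + 1) = 2 * a m ∧ τ (m + 1) = 2 * τ m + c m ∧
    ∀ n, P (m + 1) n = 2 * P m n + ℓ m n + c m ∧ 0 ≤ ℓ m n ∧ ℓ m n ≤ 1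
  third : ∀ m, ¬ a m < 1 → a m = 3 * a (m + 1) ∧ τ m = 3 * τ (m + 1) + c m ∧
    ∀ n, P m n = 3 * P (m + 1) n + ℓ m n + c m ∧ 0 ≤ ℓ m n ∧ ℓ m n ≤ 2

namespace IsDecoding

variable {a τ : ℤ → ℝ} {P ℓ : ℤ → ℤ → ℤ} {c : ℤ → ℤ}

lemma isHeightSeq (h : IsDecoding a τ P ℓ c) (n : ℤ) :
    IsHeightSeq (fun m => a m < 1) (fun m => P m n - (n * a m + τ m)) fun m => ℓ m n where
  mem m := by
    have := h.band m n
    constructor <;> linarith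
  double m hm := by
    obtain ⟨h1, h2, h3⟩ := h.double m hm
    refine ⟨?_, (h3 n).2⟩
    rw [(h3 n).1, h1, h2]
    push_cast
    ring
  third m hm := by
    obtain ⟨h1, h2, h3⟩ := h.third m hm
    refine ⟨?_, (h3 n).2⟩
    rw [(h3 n).1, h1, h2]
    push_cast
    ring

lemma eq_of_height_eq (h : IsDecoding a τ P ℓ c) {m m' n n' i i' : ℤ} (hm : m ≤ m')
    (hi : (P m n : ℝ) - (n * a m + τ m) = i) (hi' : (P m' n' : ℝ) - (n' * a m' + τ m') = i') :
    i = i' := by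
  -- Both heights are integral only in the same column, as `a m'` is irrational.
  obtain ⟨N, hN, j, hj⟩ := (h.isHeightSeq n).rational_of_le hm hi
  have hn : n = n' := by
    by_contra hne
    refine (h.irrational m').ne_rational (j - N * i' - N * (P m' n - P m' n')) (N * (n' - n)) ?_
    have hN' : (N : ℝ) ≠ 0 := by exact_mod_cast hN
    have hn' : (n' : ℝ) - n ≠ 0 := by
      rw [sub_ne_zero]
      exact_mod_cast Ne.symm hne
    push_cast
    rw [eq_div_iff (mul_ne_zero hN' hn'), ← hj, ← hi']
    ring
  subst hn
  exact (h.isHeightSeq n).eq_of_le hm hi hi'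

lemma exists_rounding (h : IsDecoding a τ P ℓ c) :
    ∃ R : Rounding, ∀ m n : ℤ, P m n = R.round (n * a m + τ m) - R.offset := by
  by_cases h1 : ∀ m n : ℤ, (P m n : ℝ) ≠ n * a m + τ m - 1
  · refine ⟨.floor, fun m n => ?_⟩
    simpa [Rounding.round, Rounding.offset] using (h.band m).eq_floor (h1 m) n
  · push Not at h1
    obtain ⟨m, n, hmn⟩ := h1
    refine ⟨.ceil, fun m' n' => (h.band m').eq_ceil (fun k hk => ?_) n'⟩
    have e1 : (P m n : ℝ) - (n * a m + τ m) = ((-1 : ℤ) : ℝ) := by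
      push_cast
      linarith
    have e2 : (P m' k : ℝ) - (k * a m' + τ m') = ((0 : ℤ) : ℝ) := by
      push_cast
      linarith
    rcases le_total m m' with hm | hm
    · exact absurd (h.eq_of_height_eq hm e1 e2) (by norm_num)
    · exact absurd (h.eq_of_height_eq hm e2 e1) (by norm_num)

lemma carry_eq {R : Rounding} {k : ℕ} {x : ℝ} {u v l b : ℤ} (hu : u = R.round x - R.offset)
    (hv : v = R.round (k * x + b) - R.offset) (h : v = k * u + l + b) : l = carry R k x := by
  rw [R.round_add_int] at hv
  rw [carry]
  have : l = v - k * u - b := by omega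
  rw [this, hu, hv]
  ring

end IsDecoding

/-! ### Decoding a tiling -/

/-- Vertical edges of rows of type `1/3`. -/
def HLabel.isThird : HLabel → Bool
  | .zeroThirds => true
  | .oneThird => true
  | .twoThirds => true
  | .zero => false
  | .negOne => false

/-- The carry of a vertical edge; see `edgeH`. -/
def HLabel.carry : HLabel → ℤ
  | .zeroThirds => 0
  | .oneThird => 1
  | .twoThirds => 2
  | .zero => 0
  | .negOne => 1

lemma edgeH_carry (l : HLabel) : edgeH l.isThird l.carry = l := by
  cases l <;> simp [edgeH, HLabel.isThird, HLabel.carry]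

lemma isThird_right {w : WangTile} (hw : w ∈ kariCulikTiles) :
    w.right.isThird = w.left.isThird := by
  simp only [kariCulikTiles, Set.mem_insert_iff, Set.mem_singleton_iff] at hw
  rcases hw with rfl | rfl | rfl | rfl | rfl | rfl | rfl | rfl | rfl | rfl | rfl | rfl | rfl <;> rfl

lemma edgeV_top {w : WangTile} (hw : w ∈ kariCulikTiles) :
    edgeV (!w.left.isThird) w.top.value = w.top := by
  simp only [kariCulikTiles, Set.mem_insert_iff, Set.mem_singleton_iff] at hw
  rcases hw with rfl | rfl | rfl | rfl | rfl | rfl | rfl | rfl | rfl | rfl | rfl | rfl | rfl <;> rfl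

lemma tile_of_isThird {w : WangTile} (hw : w ∈ kariCulikTiles) (h : w.left.isThird = true) :
    w.bottom.value + w.left.carry = 3 * w.top.value + w.right.carry ∧
      (1 ≤ w.bottom.value ∧ w.bottom.value ≤ 2) ∧ 0 ≤ w.right.carry ∧ w.right.carry ≤ 2 := by
  simp only [kariCulikTiles, Set.mem_insert_iff, Set.mem_singleton_iff] at hw
  rcases hw with rfl | rfl | rfl | rfl | rfl | rfl | rfl | rfl | rfl | rfl | rfl | rfl | rfl <;>
    simp_all [HLabel.isThird, HLabel.carry, VLabel.value]

lemma tile_of_not_isThird {w : WangTile} (hw : w ∈ kariCulikTiles) (h : w.left.isThird = false) :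
    2 * w.bottom.value + w.right.carry = w.top.value + w.left.carry ∧
      w.bottom.value ≤ 1 ∧ (0 ≤ w.right.carry ∧ w.right.carry ≤ 1) ∧
      (w.bottom ≠ .zero → 1 ≤ w.top.value) := by
  simp only [kariCulikTiles, Set.mem_insert_iff, Set.mem_singleton_iff] at hw
  rcases hw with rfl | rfl | rfl | rfl | rfl | rfl | rfl | rfl | rfl | rfl | rfl | rfl | rfl <;>
    simp_all [HLabel.isThird, HLabel.carry, VLabel.value]

lemma top_ne_zero_of_not_isThird {w : WangTile} (hw : w ∈ kariCulikTiles)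
    (h : w.left.isThird = false) : w.top ≠ .zero := by
  simp only [kariCulikTiles, Set.mem_insert_iff, Set.mem_singleton_iff] at hw
  rcases hw with rfl | rfl | rfl | rfl | rfl | rfl | rfl | rfl | rfl | rfl | rfl | rfl | rfl <;>
    simp_all [HLabel.isThird]

lemma HasAngle.le {x : ℤ → ℤ} {α : ℝ} (h : HasAngle x α) {v : ℤ} (hv : ∀ n, v ≤ x n) :
    (v : ℝ) ≤ α := by
  refine ge_of_tendsto' h fun n => ?_
  rw [le_div_iff₀ (by positivity)]
  have h1 := Finset.card_nsmul_le_sum (Finset.Icc (-(n : ℤ)) (n : ℤ)) (fun i => (x i : ℝ)) v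
    fun i _ => by exact_mod_cast hv i
  rw [Int.card_Icc, nsmul_eq_mul] at h1
  have h2 : (((n : ℤ) + 1 - -(n : ℤ)).toNat : ℝ) = 2 * n + 1 := by
    rw [show (n : ℤ) + 1 - -(n : ℤ) = ((2 * n + 1 : ℕ) : ℤ) by push_cast; ring, Int.toNat_natCast]
    push_cast
    ring
  rw [h2] at h1
  linarith

lemma HasAngle.ge {x : ℤ → ℤ} {α : ℝ} (h : HasAngle x α) {v : ℤ} (hv : ∀ n, x n ≤ v) :
    α ≤ v := by
  have h1 : HasAngle (fun n => -x n) (-α) := by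
    refine (Tendsto.neg h).congr fun n => ?_
    push_cast
    rw [Finset.sum_neg_distrib, neg_div]
  have h2 := h1.le (v := -v) fun n => neg_le_neg (hv n)
  push_cast at h2
  linarith

lemma nonpos_of_nat_mul_le {x C : ℝ} (h : ∀ n : ℕ, n * x ≤ C) : x ≤ 0 := by
  by_contra hx
  push Not at hx
  obtain ⟨n, hn⟩ := exists_nat_gt (C / x)
  rw [div_lt_iff₀ hx] at hn
  linarith [h n]

lemma IsBand.slope_eq {α α' τ τ' : ℝ} {P P' ℓ : ℤ → ℤ} {k : ℕ} {c : ℤ}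
    (h : IsBand α τ P) (h' : IsBand α' τ' P') (hstep : ∀ n, P' n = k * P n + ℓ n + c)
    (hℓ : ∀ n, 0 ≤ ℓ n ∧ ℓ n ≤ (k : ℤ) - 1) : α' = k * α := by
  have hk' : (0 : ℝ) ≤ k := by positivity
  refine le_antisymm (sub_nonpos.1 (nonpos_of_nat_mul_le (C := k * τ + k + c - τ') fun n => ?_))
    (sub_nonpos.1 (nonpos_of_nat_mul_le (C := τ' - k * (τ - 1) - c) fun n => ?_))
  · have h1 := (h' n).1
    have h2 := mul_le_mul_of_nonneg_left (h n).2 hk'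
    have h3 : (ℓ n : ℝ) ≤ k - 1 := by exact_mod_cast (hℓ n).2
    rw [hstep n] at h1
    push_cast at h1 h2
    linarith
  · have h1 := (h' n).2
    have h2 := mul_le_mul_of_nonneg_left (h n).1 hk'
    have h3 : (0 : ℝ) ≤ ℓ n := by exact_mod_cast (hℓ n).1
    rw [hstep n] at h1
    push_cast at h1 h2
    linarith

/-- Every tiling whose rows have irrational angles comes from a point of the skew product. -/
lemma exists_tilingOf_eq {y : Configuration} (hy : y ∈ KCirr) :
    ∃ (R : Rounding) (p : CoreSpace), Irrational (p.1 : ℝ) ∧ tilingOf R p = y := by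
  obtain ⟨⟨⟨htile, hright, htop⟩, hsturm⟩, hangle⟩ := hy
  choose a ha hxa using hangle
  choose P hP using fun m => exists_isPrimitive (bottomLabels y m)
  choose τ hτ using fun m => exists_isBand (hsturm m) (hxa m) (hP m)
  -- All tiles of a row have the same type.
  have htype : ∀ m n, (y m n).left.isThird = (y m 0).left.isThird := fun m n =>
    eq_of_forall_eq_succ (f := fun n => (y m n).left.isThird)
      (fun n => by rw [← hright, isThird_right (htile m n)]) n
  have hPv : ∀ m n, P m n - P m (n - 1) = (y m n).bottom.value := fun m n => hP m n
  have hleft : ∀ m n, (y m n).left = (y m (n - 1)).right := fun m n => by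
    rw [hright, sub_add_cancel]
  -- Summation of the tile equations along a row.
  have hthird : ∀ m, (y m 0).left.isThird = true → ∃ c, ∀ n,
      P m n = 3 * P (m + 1) n + (y m n).right.carry + c := by
    intro m hm
    refine ⟨P m 0 - 3 * P (m + 1) 0 - (y m 0).right.carry, fun n => ?_⟩
    have h1 := eq_of_forall_eq_succ
      (f := fun n => P m n - 3 * P (m + 1) n - (y m n).right.carry) (fun n => by
        have h2 := (tile_of_isThird (htile m (n + 1)) (by rw [htype, hm])).1
        have h3 := hPv m (n + 1)
        have h4 := hPv (m + 1) (n + 1)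
        rw [hleft, htop] at h2
        rw [add_sub_cancel_right] at h2 h3 h4
        omega) n
    beta_reduce at h1
    omega
  have hdouble : ∀ m, (y m 0).left.isThird = false → ∃ c, ∀ n,
      P (m + 1) n = 2 * P m n + (y m n).right.carry + c := by
    intro m hm
    refine ⟨P (m + 1) 0 - 2 * P m 0 - (y m 0).right.carry, fun n => ?_⟩
    have h1 := eq_of_forall_eq_succ
      (f := fun n => P (m + 1) n - 2 * P m n - (y m n).right.carry) (fun n => by
        have h2 := (tile_of_not_isThird (htile m (n + 1)) (by rw [htype, hm])).1
        have h3 := hPv m (n + 1)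
        have h4 := hPv (m + 1) (n + 1)
        rw [hleft, htop] at h2
        rw [add_sub_cancel_right] at h2 h3 h4
        omega) n
    beta_reduce at h1
    omega
  have hc3 : ∀ m, (y m 0).left.isThird = true → ∀ n,
      0 ≤ (y m n).right.carry ∧ (y m n).right.carry ≤ 2 := fun m hm n =>
    (tile_of_isThird (htile m n) (by rw [htype, hm])).2.2
  have hc2 : ∀ m, (y m 0).left.isThird = false → ∀ n,
      0 ≤ (y m n).right.carry ∧ (y m n).right.carry ≤ 1 := fun m hm n =>
    (tile_of_not_isThird (htile m n) (by rw [htype, hm])).2.2.1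
  -- The type of a row is determined by its angle.
  have hge : ∀ m, (y m 0).left.isThird = true → 1 ≤ a m ∧ a m ≤ 2 := by
    intro m hm
    have h1 := fun n => (tile_of_isThird (htile m n) (by rw [htype, hm])).2.1
    exact ⟨by simpa using (hxa m).le (v := 1) fun n => (h1 n).1,
      by simpa using (hxa m).ge (v := 2) fun n => (h1 n).2⟩
  have hle : ∀ m, (y m 0).left.isThird = false → a m ≤ 1 := fun m hm => by
    simpa using (hxa m).ge (v := 1)
      fun n => (tile_of_not_isThird (htile m n) (by rw [htype, hm])).2.1
  have hlt : ∀ m, a m < 1 ↔ (y m 0).left.isThird = false := by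
    intro m
    constructor
    · intro h
      by_contra h'
      linarith [(hge m (by simpa using h')).1]
    · exact fun h => lt_of_le_of_ne (hle m h) (ha m).ne_one
  have hnlt : ∀ m, ¬ a m < 1 ↔ (y m 0).left.isThird = true := fun m => by
    rw [hlt, Bool.not_eq_false]
  have hdec : ∃ c, IsDecoding a τ P (fun m n => (y m n).right.carry) c := by
    have hex : ∀ m, ∃ c : ℤ, (a m < 1 → ∀ n, P (m + 1) n = 2 * P m n + (y m n).right.carry + c) ∧
        (¬ a m < 1 → ∀ n, P m n = 3 * P (m + 1) n + (y m n).right.carry + c) := by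
      intro m
      by_cases h : a m < 1
      · obtain ⟨c, hc⟩ := hdouble m ((hlt m).1 h)
        exact ⟨c, fun _ => hc, fun h' => absurd h h'⟩
      · obtain ⟨c, hc⟩ := hthird m ((hnlt m).1 h)
        exact ⟨c, fun h' => absurd h' h, fun _ => hc⟩
    choose c hc using hex
    refine ⟨c, ha, hτ, fun m h => ?_, fun m h => ?_⟩
    · have h1 := hc2 m ((hlt m).1 h)
      have h2 := (hτ m).slope_eq (k := 2) (hτ (m + 1)) ((hc m).1 h) (by simpa using h1)
      have h3 := (hτ m).mul_step (k := 2) two_pos (ha m) (h2 ▸ hτ (m + 1)) ((hc m).1 h)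
        (by simpa using h1)
      exact ⟨by simpa using h2, by simpa using h3, fun n => ⟨(hc m).1 h n, h1 n⟩⟩
    · have h1 := hc3 m ((hnlt m).1 h)
      have h2 := (hτ (m + 1)).slope_eq (k := 3) (hτ m) ((hc m).2 h) (by simpa using h1)
      have h3 := (hτ (m + 1)).mul_step (k := 3) three_pos (ha (m + 1)) (h2 ▸ hτ m) ((hc m).2 h)
        (by simpa using h1)
      exact ⟨by simpa using h2, by simpa using h3, fun n => ⟨(hc m).2 h n, h1 n⟩⟩
  obtain ⟨c, hc⟩ := hdec
  have hbounds : ∀ m, 1 / 3 ≤ a m ∧ a m < 2 := by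
    intro m
    refine ⟨?_, ?_⟩
    · by_cases h : a m < 1
      · obtain ⟨m, rfl⟩ : ∃ k, m = k + 1 := ⟨m - 1, by ring⟩
        by_cases h' : a m < 1
        · -- After a row of type `2` the label `0` does not occur, which excludes small angles.
          have h1 : ∀ n, 1 ≤ bottomLabels y (m + 1 + 1) n := fun n => by
            refine le_of_le_of_eq ((tile_of_not_isThird (htile (m + 1) n)
              (by rw [htype, (hlt _).1 h])).2.2.2 ?_) (congrArg _ (htop (m + 1) n))
            rw [← htop]
            exact top_ne_zero_of_not_isThird (htile m n) (by rw [htype, (hlt _).1 h'])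
          have h2 := (hxa (m + 1 + 1)).le h1
          rw [(hc.double _ h).1] at h2
          push_cast at h2
          linarith
        · have h1 := (hc.third m h').1
          linarith
      · linarith
    · by_cases h : a m < 1
      · linarith
      · exact lt_of_le_of_ne (hge m ((hnlt m).1 h)).2 (by exact_mod_cast (ha m).ne_nat 2)
  obtain ⟨R, hR⟩ := hc.exists_rounding
  have hstep : IsStepSeq (fun m => a m < 1) fun m => (τ m : AddCircle ((6 : ℝ) ^ 0)) := by
    refine fun m => ⟨fun h => ?_, fun h => ?_⟩
    · rw [← AddCircle.coe_nsmul, coe_eq_coe_iff]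
      refine ⟨-c m, ?_⟩
      rw [(hc.double m h).2.1, nsmul_eq_mul]
      push_cast
      ring
    · rw [← AddCircle.coe_nsmul, coe_eq_coe_iff]
      refine ⟨c m, ?_⟩
      rw [(hc.third m h).2.1, nsmul_eq_mul]
      push_cast
      ring
  have hdiv : ∀ m, ¬ a m < 1 → a (m + 1) = a m / 3 := fun m h => by linarith [(hc.third m h).1]
  obtain ⟨p, hpa, hpσ, hp⟩ := exists_orbit hbounds (fun m h => (hc.double m h).1) hdiv hstep
  refine ⟨R, p 0, by rw [hpa]; exact ha 0, ?_⟩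
  -- The phases of the row `m` of the orbit.
  have hphase : ∀ m n : ℤ, ((n * a m + τ m : ℝ) : AddCircle ((6 : ℝ) ^ 0))
      = basePhase ((rot ^ n) (p m)).2 := by
    intro m n
    rw [rot_zpow_apply, map_add, hpσ, zsmul_solenoidOfReal, basePhase_solenoidOfReal, hpa,
      add_comm, AddCircle.coe_add]
  have hfst : ∀ m n : ℤ, (((rot ^ n) (p m)).1 : ℝ) = a m := fun m n => by
    rw [rot_zpow_apply, hpa]
  have hskew : ∀ m n : ℤ, skew ((rot ^ n) (p m)) = (rot ^ n) (p (m + 1)) := fun m n => by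
    rw [← hp (m + 1), zpow_add_one_apply, hp]
    exact skew_zpow_rot_zpow 1 n (p m)
  have hbottom : ∀ m n, bottomEdge R ((rot ^ n) (p m)) = (y m n).bottom := by
    intro m n
    have h1 : bottomValue R ((rot ^ n) (p m)) = (y m n).bottom.value := by
      rw [bottomValue_eq R _ (hphase m n), hfst, ← hPv, hR m n, hR m (n - 1)]
      push_cast
      rw [show ((n : ℝ) - 1) * a m + τ m = n * a m + τ m - a m by ring]
      ring
    obtain ⟨m, rfl⟩ : ∃ k, m = k + 1 := ⟨m - 1, by ring⟩
    have h2 : decide (2 / 3 ≤ a (m + 1)) = !(y m n).left.isThird := by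
      rw [htype]
      by_cases h : a m < 1
      · rw [(hlt m).1 h, (hc.double m h).1]
        simp only [Bool.not_false, decide_eq_true_eq]
        linarith [(hbounds m).1]
      · rw [(hnlt m).1 h, hdiv m h]
        simp only [Bool.not_true, decide_eq_false_iff_not, not_le]
        linarith [(hbounds m).2]
    rw [bottomEdge, h1, hfst, h2, ← htop]
    exact edgeV_top (htile m n)
  have hside : ∀ m n, sideEdge R ((rot ^ n) (p m)) = (y m n).right := by
    intro m n
    rw [← edgeH_carry (y m n).right, isThird_right (htile m n), htype]
    by_cases h : a m < 1
    · rw [sideEdge_of_lt R (by rwa [hfst]) (hphase m n), (hlt m).1 h]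
      obtain ⟨h1, h2, h3⟩ := hc.double m h
      rw [IsDecoding.carry_eq (k := 2) (hR m n) ((hR (m + 1) n).trans ?_) (h3 n).1]
      rw [h1, h2]
      push_cast
      congr 2
      ring
    · have hph := hphase (m + 1) n
      rw [← hskew] at hph
      rw [sideEdge_of_not_lt R (by rwa [hfst]) hph, (hnlt m).1 h]
      obtain ⟨h1, h2, h3⟩ := hc.third m h
      rw [IsDecoding.carry_eq (k := 3) (hR (m + 1) n) ((hR m n).trans ?_) (h3 n).1]
      rw [h1, h2]
      push_cast
      congr 2
      ring
  have hrot : ∀ m n : ℤ, rot⁻¹ ((rot ^ n) (p m)) = (rot ^ (n - 1)) (p m) := fun m n => by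
    rw [← Equiv.Perm.mul_apply, ← zpow_neg_one, ← zpow_add, neg_add_eq_sub]
  funext m n
  rw [tilingOf, skew_zpow_rot_zpow, hp, tileOf, hskew, hrot, hbottom, hbottom, hside, hside,
    ← hleft, ← htop]

/-! ### The conjugacy -/

/-- The retraction of the parameter space to the core, which sends the angle `2` to the angle
`1 / 3`: both are mapped to `2 / 3` by the skew product. -/
def toCoreBase (p : ParamSpace) : CoreSpace := skew.symm (toCore p)

lemma toCoreBase_coreInclusion (q : CoreSpace) : toCoreBase (coreInclusion q) = q :=
  skew.symm_apply_apply q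

lemma toCoreBase_add (α : Set.Icc (1 / 3 : ℝ) 2) (t : solenoid) :
    toCoreBase (α, t + solenoidOfReal α) = rot (toCoreBase (α, t)) := by
  rw [toCoreBase, toCore_add]
  exact congrArg (fun e : Equiv.Perm CoreSpace => e _) commute_skew_rot.inv_left.eq

lemma toCoreBase_fHat (p : ParamSpace) : toCoreBase (fHat p) = skew (toCoreBase p) := by
  rw [← coreInclusion_toCore, toCoreBase_coreInclusion, toCoreBase, Equiv.apply_symm_apply]

lemma exists_coreInclusion_eq {p : ParamSpace} (h : (p.1 : ℝ) ≠ 2) :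
    ∃ q : CoreSpace, coreInclusion q = p :=
  ⟨(⟨p.1, p.1.2.1, lt_of_le_of_ne p.1.2.2 h⟩, p.2), rfl⟩

lemma isOrbitOf_coreInclusion (q : CoreSpace) :
    IsOrbitOf (fun m => coreInclusion ((skew ^ m) q)) (coreInclusion q) :=
  ⟨rfl, fun m => by beta_reduce; rw [zpow_add_one_apply, coreInclusion_skew]⟩

lemma isCodedBy_tilingOf (R : Rounding) (q : CoreSpace) :
    IsCodedBy (tilingOf R q) (fun m => coreInclusion ((skew ^ m) q)) R :=
  fun m _ hs => bottomLabels_tilingOf R q m hs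

/-- A parameter of a tiling with irrational angles. -/
def paramOf (y : KCirr) : CoreSpace := (exists_tilingOf_eq y.2).choose_spec.choose

lemma irrational_paramOf (y : KCirr) : Irrational ((paramOf y).1 : ℝ) :=
  (exists_tilingOf_eq y.2).choose_spec.choose_spec.1

open Classical in
/-- A rounding for a tiling with irrational angles. Where both roundings give the same tiling the
floor is taken, so that the choice is invariant under translations. -/
def roundingOf (y : KCirr) : Rounding :=
  if tilingOf .floor (paramOf y) = y then .floor else .ceil

lemma tilingOf_paramOf (y : KCirr) : tilingOf (roundingOf y) (paramOf y) = y := by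
  have h : tilingOf (exists_tilingOf_eq y.2).choose (paramOf y) = y :=
    (exists_tilingOf_eq y.2).choose_spec.choose_spec.2
  unfold roundingOf
  split_ifs with hf
  · exact hf
  · cases hR : (exists_tilingOf_eq y.2).choose with
    | floor => exact absurd (hR ▸ h) hf
    | ceil => exact hR ▸ h

lemma paramOf_eq {y : KCirr} {R : Rounding} {q : CoreSpace} (h : tilingOf R q = y) :
    paramOf y = q :=
  tilingOf_injective (irrational_paramOf y) ((tilingOf_paramOf y).trans h.symm)

/-- The rounding is preserved by a translation of the tilings that corresponds to a map `g` of the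
parameters. -/
lemma roundingOf_eq {y z : KCirr} {g : CoreSpace → CoreSpace} {s : Configuration → Configuration}
    (hs : Function.Injective s) (hg : ∀ R q, tilingOf R (g q) = s (tilingOf R q))
    (hz : (z : Configuration) = s y) (hp : paramOf z = g (paramOf y)) :
    roundingOf z = roundingOf y := by
  have h : tilingOf .floor (paramOf z) = z ↔ tilingOf .floor (paramOf y) = y := by
    rw [hp, hg, hz, hs.eq_iff]
  unfold roundingOf
  by_cases hy : tilingOf .floor (paramOf y) = y
  · rw [if_pos hy, if_pos (h.2 hy)]
  · rw [if_neg hy, if_neg fun hz' => hy (h.1 hz')]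

lemma shiftT_injective : Function.Injective shiftT := fun y z h => by
  funext m n
  simpa [shiftT] using congrFun (congrFun h m) (n - 1)

lemma shiftS_injective : Function.Injective shiftS := fun y z h => by
  funext m n
  simpa [shiftS] using congrFun (congrFun h (m - 1)) n

lemma paramOf_T (y : KCirr) : paramOf (KCirr.T y) = rot (paramOf y) :=
  paramOf_eq (R := roundingOf y) ((tilingOf_rot _ _).trans (congrArg shiftT (tilingOf_paramOf y)))

lemma paramOf_S (y : KCirr) : paramOf (KCirr.S y) = skew (paramOf y) :=
  paramOf_eq (R := roundingOf y) ((tilingOf_skew _ _).trans (congrArg shiftS (tilingOf_paramOf y)))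

end

theorem mainTheorem2 :
    ∃ (K : ParamSpace × Rounding → KC) (K' : KCirr → ParamSpace × Rounding),
      -- `K'` parametrizes the tilings all of whose rows have an irrational angle
      (∀ y : KCirr, (K (K' y) : Configuration) = (y : Configuration)) ∧
      -- under `K'` the translations become the skew product
      (∀ (y : KCirr) (α : Set.Icc (1 / 3 : ℝ) 2) (t : solenoid) (R : Rounding),
        K' y = ((α, t), R) →
          K' (KCirr.T y) = ((α, t + solenoidOfReal α), R) ∧
          K' (KCirr.S y) = (fHat (α, t), R)) ∧
      -- the rows of `K ((α, t), R)` are the rotation sequences given by the orbit of `(α, t)`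
      (∀ (α : Set.Icc (1 / 3 : ℝ) 2) (t : solenoid) (R : Rounding), (α : ℝ) ≠ 2 →
        ∃ p : ℤ → ParamSpace, IsOrbitOf p (α, t) ∧ IsCodedBy (K ((α, t), R)) p R) ∧
      -- `K` is equivariant on the whole parameter space
      (∀ (α : Set.Icc (1 / 3 : ℝ) 2) (t : solenoid) (R : Rounding),
        K ((α, t + solenoidOfReal α), R) = KC.T (K ((α, t), R)) ∧
        K (fHat (α, t), R) = KC.S (K ((α, t), R))) ∧
      -- over irrational angles `K` takes values in `KCirr`, and `K'` recovers `(α, t)`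
      (∀ (α : Set.Icc (1 / 3 : ℝ) 2) (t : solenoid) (R : Rounding), Irrational (α : ℝ) →
        ∃ h : (K ((α, t), R) : Configuration) ∈ KCirr, (K' ⟨K ((α, t), R), h⟩).1 = (α, t)) := by

  refine ⟨fun x => ⟨tilingOf x.2 (toCoreBase x.1), tilingOf_mem_KC _ _⟩,
    fun y => (coreInclusion (paramOf y), roundingOf y), fun y => ?_, ?_, ?_, fun α t R => ⟨?_, ?_⟩,
    ?_⟩
  · change tilingOf _ (toCoreBase (coreInclusion _)) = _
    rw [toCoreBase_coreInclusion, tilingOf_paramOf]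
  · intro y α t R h
    obtain ⟨h1, rfl⟩ := Prod.ext_iff.1 h
    change coreInclusion (paramOf y) = (α, t) at h1
    rw [← h1, ← coreInclusion_skew, ← paramOf_S]
    refine ⟨Prod.ext ?_ (roundingOf_eq shiftT_injective tilingOf_rot rfl (paramOf_T y)),
      Prod.ext rfl (roundingOf_eq shiftS_injective tilingOf_skew rfl (paramOf_S y))⟩
    change coreInclusion (paramOf (KCirr.T y)) = _
    rw [paramOf_T]
    obtain ⟨rfl, rfl⟩ := Prod.ext_iff.1 h1
    rfl
  · intro α t R hα
    obtain ⟨q, hq⟩ := exists_coreInclusion_eq (p := (α, t)) hα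
    simp only [← hq, toCoreBase_coreInclusion]
    exact ⟨_, isOrbitOf_coreInclusion q, isCodedBy_tilingOf R q⟩
  · refine Subtype.ext ?_
    change tilingOf R (toCoreBase _) = shiftT (tilingOf R _)
    rw [toCoreBase_add, tilingOf_rot]
  · refine Subtype.ext ?_
    change tilingOf R (toCoreBase _) = shiftS (tilingOf R _)
    rw [toCoreBase_fHat, tilingOf_skew]
  · intro α t R hα
    obtain ⟨q, hq⟩ := exists_coreInclusion_eq (p := (α, t)) (by exact_mod_cast hα.ne_nat 2)
    have hqα : Irrational (q.1 : ℝ) := by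
      obtain ⟨rfl, -⟩ := Prod.ext_iff.1 hq
      exact hα
    have hbase : toCoreBase (α, t) = q := by rw [← hq, toCoreBase_coreInclusion]
    have hmem : tilingOf R (toCoreBase (α, t)) ∈ KCirr := by
      rw [hbase]
      exact tilingOf_mem_KCirr R hqα
    refine ⟨hmem, ?_⟩
    change coreInclusion (paramOf _) = (α, t)
    rw [paramOf_eq (R := R) (q := toCoreBase (α, t)) rfl, hbase, hq]
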